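/- Let $k$ be an algebraically closed field of characteristic $0$ and let $q\in k^\times$ be not a root of unity. Let $U=U_q(\mathfrak{sl}_2)$ be the $k$-algebra generated by $E,F,K,K^{-1}$ with relations $$KK^{-1}=K^{-1}K=1,\qquad KE=q^2EK,\qquad FK=q^2KF,\qquad EF-FE=\frac{K-K^{-1}}{q-q^{-1}},$$ with the Hopf algebra structure $$\Delta(E)=E\otimes 1+K\otimes E,\quad \Delta(F)=F\otimes K^{-1}+1\otimes F,\quad \Delta(K^{\pm1})=K^{\pm1}\otimes K^{\pm1},$$ $\varepsilon(E)=\varepsilon(F)=0$, $\varepsilon(K^{\pm1})=1$, $S(E)=-K^{-1}E$, $S(F)=-FK$, $S(K^{\pm1})=K^{\mp1}$. A right coideal subalgebra of $U$ is a (unital) subalgebra $C\subseteq U$ with $\Delta(C)\subseteq C\otimes U$. An algebra is called basic if all its finite-dimensional irreducible representations are one-dimensional. A Borel subalgebra of $U$ is a basic right coideal subalgebra that is maximal with respect to inclusion among all basic right coideal subalgebras of $U$. Theorem. The Borel subalgebras of $U_q(\mathfrak{sl}_2)$ are exactly the following: (1) the subalgebra $U^{\ge 0}$ generated by $E,K,K^{-1}$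 and the subalgebra $U^{\le 0}$ generated by $F,K,K^{-1}$; (2) for every pair of scalars $\lambda,\lambda'\in k$ with $\lambda\lambda'=\dfrac{q^2}{(1-q^2)(q-q^{-1})}$, the subalgebra $B_{\lambda,\lambda'}$ generated by $EK^{-1}+\lambda K^{-1}$ and $F+\lambda' K^{-1}$. -/

import Mathlib

open scoped TensorProduct

universe u v

/-! ### The quantum group `U_q(sl_2)` as a Hopf algebra -/

/-- The four generators `E`, `F`, `K`, `K⁻¹` of `U_q(sl_2)`. -/
inductive Uqsl2Gen : Type
  | E | F | K | Kinv

/-- The defining relations of `U_q(sl_2)`: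
`K K⁻¹ = K⁻¹ K = 1`, `K E = q² E K`, `F K = q² K F` and
`E F - F E = (K - K⁻¹) / (q - q⁻¹)`. -/
inductive Uqsl2Rel {k : Type u} [Field k] (q : k) :
    FreeAlgebra k Uqsl2Gen → FreeAlgebra k Uqsl2Gen → Prop
  | K_mul_Kinv :
      Uqsl2Rel q (FreeAlgebra.ι k Uqsl2Gen.K * FreeAlgebra.ι k Uqsl2Gen.Kinv) 1
  | Kinv_mul_K :
      Uqsl2Rel q (FreeAlgebra.ι k Uqsl2Gen.Kinv * FreeAlgebra.ι k Uqsl2Gen.K) 1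
  | K_mul_E :
      Uqsl2Rel q (FreeAlgebra.ι k Uqsl2Gen.K * FreeAlgebra.ι k Uqsl2Gen.E)
        (q ^ 2 • (FreeAlgebra.ι k Uqsl2Gen.E * FreeAlgebra.ι k Uqsl2Gen.K))
  | F_mul_K :
      Uqsl2Rel q (FreeAlgebra.ι k Uqsl2Gen.F * FreeAlgebra.ι k Uqsl2Gen.K)
        (q ^ 2 • (FreeAlgebra.ι k Uqsl2Gen.K * FreeAlgebra.ι k Uqsl2Gen.F))
  | E_mul_F :
      Uqsl2Rel q
        (FreeAlgebra.ι k Uqsl2Gen.E * FreeAlgebra.ι k Uqsl2Gen.F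
          - FreeAlgebra.ι k Uqsl2Gen.F * FreeAlgebra.ι k Uqsl2Gen.E)
        ((q - q⁻¹)⁻¹ • (FreeAlgebra.ι k Uqsl2Gen.K - FreeAlgebra.ι k Uqsl2Gen.Kinv))

/-- The quantum group `U_q(sl_2)` over the field `k`. -/
def Uqsl2 {k : Type u} [Field k] (q : k) : Type u := RingQuot (Uqsl2Rel q)

namespace Uqsl2

instance instRing {k : Type u} [Field k] (q : k) : Ring (Uqsl2 q) :=
  inferInstanceAs (Ring (RingQuot (Uqsl2Rel q)))

instance instAlgebra {k : Type u} [Field k] (q : k) : Algebra k (Uqsl2 q) :=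
  inferInstanceAs (Algebra k (RingQuot (Uqsl2Rel q)))

/-- The quotient map from the free algebra. -/
noncomputable def mk {k : Type u} [Field k] (q : k) : FreeAlgebra k Uqsl2Gen →ₐ[k] Uqsl2 q :=
  RingQuot.mkAlgHom k (Uqsl2Rel q)

/-- The generator `E`. -/
noncomputable def E {k : Type u} [Field k] (q : k) : Uqsl2 q :=
  mk q (FreeAlgebra.ι k Uqsl2Gen.E)

/-- The generator `F`. -/
noncomputable def F {k : Type u} [Field k] (q : k) : Uqsl2 q :=
  mk q (FreeAlgebra.ι k Uqsl2Gen.F)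

/-- The generator `K`. -/
noncomputable def K {k : Type u} [Field k] (q : k) : Uqsl2 q :=
  mk q (FreeAlgebra.ι k Uqsl2Gen.K)

/-- The generator `K⁻¹`. -/
noncomputable def Kinv {k : Type u} [Field k] (q : k) : Uqsl2 q :=
  mk q (FreeAlgebra.ι k Uqsl2Gen.Kinv)

theorem K_mul_Kinv {k : Type u} [Field k] (q : k) : K q * Kinv q = 1 := by
  have h := RingQuot.mkAlgHom_rel k (Uqsl2Rel.K_mul_Kinv (q := q))
  rw [map_mul, map_one] at h
  exact h

theorem Kinv_mul_K {k : Type u} [Field k] (q : k) : Kinv q * K q = 1 := by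
  have h := RingQuot.mkAlgHom_rel k (Uqsl2Rel.Kinv_mul_K (q := q))
  rw [map_mul, map_one] at h
  exact h

theorem K_mul_E {k : Type u} [Field k] (q : k) : K q * E q = q ^ 2 • (E q * K q) := by
  have h := RingQuot.mkAlgHom_rel k (Uqsl2Rel.K_mul_E (q := q))
  rw [map_mul, map_smul, map_mul] at h
  exact h

theorem F_mul_K {k : Type u} [Field k] (q : k) : F q * K q = q ^ 2 • (K q * F q) := by
  have h := RingQuot.mkAlgHom_rel k (Uqsl2Rel.F_mul_K (q := q))
  rw [map_mul, map_smul, map_mul] at h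
  exact h

theorem E_mul_F {k : Type u} [Field k] (q : k) :
    E q * F q - F q * E q = (q - q⁻¹)⁻¹ • (K q - Kinv q) := by
  have h := RingQuot.mkAlgHom_rel k (Uqsl2Rel.E_mul_F (q := q))
  rw [map_sub, map_mul, map_mul, map_smul, map_sub] at h
  exact h

theorem E_mul_Kinv {k : Type u} [Field k] (q : k) :
    E q * Kinv q = q ^ 2 • (Kinv q * E q) := by
  calc E q * Kinv q = Kinv q * (K q * E q) * Kinv q := by
        rw [← mul_assoc, Kinv_mul_K, one_mul]
    _ = q ^ 2 • (Kinv q * E q) := by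
        rw [K_mul_E, mul_smul_comm, smul_mul_assoc, mul_assoc, mul_assoc, K_mul_Kinv, mul_one]

theorem Kinv_mul_F {k : Type u} [Field k] (q : k) :
    Kinv q * F q = q ^ 2 • (F q * Kinv q) := by
  calc Kinv q * F q = Kinv q * (F q * K q) * Kinv q := by
        rw [mul_assoc, mul_assoc, K_mul_Kinv, mul_one]
    _ = q ^ 2 • (F q * Kinv q) := by
        rw [F_mul_K, mul_smul_comm, smul_mul_assoc, ← mul_assoc, Kinv_mul_K, one_mul]

/-- The universal property: four elements that satisfy the relations define an algebra map. -/
noncomputable def lift {k : Type u} [Field k] (q : k) {A : Type v} [Ring A] [Algebra k A]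
    (e f x y : A) (hxy : x * y = 1) (hyx : y * x = 1) (hxe : x * e = q ^ 2 • (e * x))
    (hfx : f * x = q ^ 2 • (x * f)) (hef : e * f - f * e = (q - q⁻¹)⁻¹ • (x - y)) :
    Uqsl2 q →ₐ[k] A :=
  RingQuot.liftAlgHom k (s := Uqsl2Rel q)
    ⟨FreeAlgebra.lift k (fun g : Uqsl2Gen => match g with
      | Uqsl2Gen.E => e
      | Uqsl2Gen.F => f
      | Uqsl2Gen.K => x
      | Uqsl2Gen.Kinv => y), by
      intro a b h
      cases h <;> simp [hxy, hyx, hxe, hfx, hef]⟩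

section liftLemmas

variable {k : Type u} [Field k] (q : k) {A : Type v} [Ring A] [Algebra k A]
    (e f x y : A) (hxy : x * y = 1) (hyx : y * x = 1) (hxe : x * e = q ^ 2 • (e * x))
    (hfx : f * x = q ^ 2 • (x * f)) (hef : e * f - f * e = (q - q⁻¹)⁻¹ • (x - y))

theorem lift_E : lift q e f x y hxy hyx hxe hfx hef (E q) = e :=
  (RingQuot.liftAlgHom_mkAlgHom_apply k _ _ _).trans (FreeAlgebra.lift_ι_apply _ _)

theorem lift_F : lift q e f x y hxy hyx hxe hfx hef (F q) = f :=
  (RingQuot.liftAlgHom_mkAlgHom_apply k _ _ _).trans (FreeAlgebra.lift_ι_apply _ _)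

theorem lift_K : lift q e f x y hxy hyx hxe hfx hef (K q) = x :=
  (RingQuot.liftAlgHom_mkAlgHom_apply k _ _ _).trans (FreeAlgebra.lift_ι_apply _ _)

theorem lift_Kinv : lift q e f x y hxy hyx hxe hfx hef (Kinv q) = y :=
  (RingQuot.liftAlgHom_mkAlgHom_apply k _ _ _).trans (FreeAlgebra.lift_ι_apply _ _)

end liftLemmas

theorem algHom_ext {k : Type u} [Field k] {q : k} {A : Type v} [Ring A] [Algebra k A]
    {φ ψ : Uqsl2 q →ₐ[k] A} (hE : φ (E q) = ψ (E q)) (hF : φ (F q) = ψ (F q))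
    (hK : φ (K q) = ψ (K q)) (hKinv : φ (Kinv q) = ψ (Kinv q)) : φ = ψ := by
  refine RingQuot.ringQuot_ext' (S := k) (s := Uqsl2Rel q) φ ψ ?_
  refine FreeAlgebra.hom_ext ?_
  funext g
  cases g
  · exact hE
  · exact hF
  · exact hK
  · exact hKinv

theorem adjoin_generators {k : Type u} [Field k] (q : k) :
    Algebra.adjoin k ({E q, F q, K q, Kinv q} : Set (Uqsl2 q)) = ⊤ := by
  rw [eq_top_iff]
  intro a _
  obtain ⟨b, rfl⟩ := RingQuot.mkAlgHom_surjective k (Uqsl2Rel q) a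
  induction b using FreeAlgebra.induction with
  | grade0 r => rw [AlgHom.commutes]; exact Subalgebra.algebraMap_mem _ r
  | grade1 g =>
    refine Algebra.subset_adjoin ?_
    cases g
    · exact Or.inl rfl
    · exact Or.inr (Or.inl rfl)
    · exact Or.inr (Or.inr (Or.inl rfl))
    · exact Or.inr (Or.inr (Or.inr rfl))
  | mul a b ha hb => rw [map_mul]; exact Subalgebra.mul_mem _ (ha trivial) (hb trivial)
  | add a b ha hb => rw [map_add]; exact Subalgebra.add_mem _ (ha trivial) (hb trivial)

/-- The comultiplication: `Δ(E) = E ⊗ 1 + K ⊗ E`, `Δ(F) = F ⊗ K⁻¹ + 1 ⊗ F`,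
`Δ(K) = K ⊗ K`, `Δ(K⁻¹) = K⁻¹ ⊗ K⁻¹`. -/
noncomputable def comulHom {k : Type u} [Field k] (q : k) :
    Uqsl2 q →ₐ[k] Uqsl2 q ⊗[k] Uqsl2 q :=
  lift q (E q ⊗ₜ[k] 1 + K q ⊗ₜ[k] E q) (F q ⊗ₜ[k] Kinv q + 1 ⊗ₜ[k] F q)
    (K q ⊗ₜ[k] K q) (Kinv q ⊗ₜ[k] Kinv q)
    (by rw [Algebra.TensorProduct.tmul_mul_tmul, K_mul_Kinv, Algebra.TensorProduct.one_def])
    (by rw [Algebra.TensorProduct.tmul_mul_tmul, Kinv_mul_K, Algebra.TensorProduct.one_def])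
    (by
      simp only [mul_add, add_mul, Algebra.TensorProduct.tmul_mul_tmul, K_mul_E, mul_one, one_mul,
        smul_add, TensorProduct.smul_tmul', TensorProduct.tmul_smul])
    (by
      simp only [mul_add, add_mul, Algebra.TensorProduct.tmul_mul_tmul, F_mul_K, mul_one, one_mul,
        K_mul_Kinv, Kinv_mul_K, smul_add, TensorProduct.smul_tmul', TensorProduct.tmul_smul])
    (by
      have h1 : (K q * F q) ⊗ₜ[k] (E q * Kinv q) = (F q * K q) ⊗ₜ[k] (Kinv q * E q) := by
        rw [E_mul_Kinv, F_mul_K, TensorProduct.tmul_smul, TensorProduct.smul_tmul']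
      have h2 : E q * F q = F q * E q + (q - q⁻¹)⁻¹ • (K q - Kinv q) := by
        rw [← E_mul_F]; abel
      simp only [mul_add, add_mul, Algebra.TensorProduct.tmul_mul_tmul, mul_one, one_mul]
      rw [h1, h2]
      simp only [TensorProduct.add_tmul, TensorProduct.tmul_add, TensorProduct.tmul_smul,
        ← TensorProduct.smul_tmul', TensorProduct.sub_tmul, TensorProduct.tmul_sub, smul_sub]
      abel)

/-- The counit: `ε(E) = ε(F) = 0` and `ε(K) = ε(K⁻¹) = 1`. -/
noncomputable def counitHom {k : Type u} [Field k] (q : k) : Uqsl2 q →ₐ[k] k :=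
  lift q 0 0 1 1 (by simp) (by simp) (by simp) (by simp) (by simp)

theorem comulHom_E {k : Type u} [Field k] (q : k) :
    comulHom q (E q) = E q ⊗ₜ[k] 1 + K q ⊗ₜ[k] E q := lift_E ..

theorem comulHom_F {k : Type u} [Field k] (q : k) :
    comulHom q (F q) = F q ⊗ₜ[k] Kinv q + 1 ⊗ₜ[k] F q := lift_F ..

theorem comulHom_K {k : Type u} [Field k] (q : k) :
    comulHom q (K q) = K q ⊗ₜ[k] K q := lift_K ..

theorem comulHom_Kinv {k : Type u} [Field k] (q : k) :
    comulHom q (Kinv q) = Kinv q ⊗ₜ[k] Kinv q := lift_Kinv ..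

theorem counitHom_E {k : Type u} [Field k] (q : k) : counitHom q (E q) = 0 := lift_E ..

theorem counitHom_F {k : Type u} [Field k] (q : k) : counitHom q (F q) = 0 := lift_F ..

theorem counitHom_K {k : Type u} [Field k] (q : k) : counitHom q (K q) = 1 := lift_K ..

theorem counitHom_Kinv {k : Type u} [Field k] (q : k) : counitHom q (Kinv q) = 1 := lift_Kinv ..

noncomputable instance instBialgebra {k : Type u} [Field k] (q : k) : Bialgebra k (Uqsl2 q) :=
  Bialgebra.ofAlgHom (comulHom q) (counitHom q)
    (by
      apply algHom_ext <;>
        simp [comulHom_E, comulHom_F, comulHom_K, comulHom_Kinv, TensorProduct.add_tmul,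
          TensorProduct.tmul_add, Algebra.TensorProduct.one_def, add_assoc])
    (by
      apply algHom_ext <;>
        simp [comulHom_E, comulHom_F, comulHom_K, comulHom_Kinv, counitHom_E, counitHom_F,
          counitHom_K, counitHom_Kinv])
    (by
      apply algHom_ext <;>
        simp [comulHom_E, comulHom_F, comulHom_K, comulHom_Kinv, counitHom_E, counitHom_F,
          counitHom_K, counitHom_Kinv])

/-- The antipode as an algebra map to the opposite algebra:
`S(E) = -K⁻¹ E`, `S(F) = -F K`, `S(K) = K⁻¹`, `S(K⁻¹) = K`. -/
noncomputable def antipodeHom {k : Type u} [Field k] (q : k) : Uqsl2 q →ₐ[k] (Uqsl2 q)ᵐᵒᵖ :=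
  lift q (MulOpposite.op (-(Kinv q * E q))) (MulOpposite.op (-(F q * K q)))
    (MulOpposite.op (Kinv q)) (MulOpposite.op (K q))
    (by rw [← MulOpposite.op_mul, K_mul_Kinv, MulOpposite.op_one])
    (by rw [← MulOpposite.op_mul, Kinv_mul_K, MulOpposite.op_one])
    (by
      rw [← MulOpposite.op_mul, ← MulOpposite.op_mul, ← MulOpposite.op_smul, neg_mul, mul_neg,
        mul_assoc, E_mul_Kinv, mul_smul_comm, smul_neg])
    (by
      rw [← MulOpposite.op_mul, ← MulOpposite.op_mul, ← MulOpposite.op_smul, neg_mul, mul_neg,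
        ← mul_assoc, Kinv_mul_F, smul_mul_assoc, mul_assoc, Kinv_mul_K, mul_assoc, K_mul_Kinv,
        smul_neg])
    (by
      have h1 : F q * K q * (Kinv q * E q) = F q * E q := by
        rw [mul_assoc, ← mul_assoc (K q), K_mul_Kinv, one_mul]
      have h2 : Kinv q * E q * (F q * K q) = E q * F q := by
        have h3 : E q * (F q * K q) = K q * (E q * F q) := by
          rw [F_mul_K, mul_smul_comm, ← mul_assoc, ← mul_assoc, K_mul_E, smul_mul_assoc]
        rw [mul_assoc, h3, ← mul_assoc, Kinv_mul_K, one_mul]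
      rw [← MulOpposite.op_mul, ← MulOpposite.op_mul, ← MulOpposite.op_sub, ← MulOpposite.op_sub,
        ← MulOpposite.op_smul, neg_mul_neg, neg_mul_neg, h1, h2, ← neg_sub (K q), smul_neg,
        ← E_mul_F, neg_sub])

theorem antipodeHom_E {k : Type u} [Field k] (q : k) :
    antipodeHom q (E q) = MulOpposite.op (-(Kinv q * E q)) := lift_E ..

theorem antipodeHom_F {k : Type u} [Field k] (q : k) :
    antipodeHom q (F q) = MulOpposite.op (-(F q * K q)) := lift_F ..

theorem antipodeHom_K {k : Type u} [Field k] (q : k) :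
    antipodeHom q (K q) = MulOpposite.op (Kinv q) := lift_K ..

theorem antipodeHom_Kinv {k : Type u} [Field k] (q : k) :
    antipodeHom q (Kinv q) = MulOpposite.op (K q) := lift_Kinv ..

/-- The antipode as a linear map. -/
noncomputable def antipodeLin {k : Type u} [Field k] (q : k) : Uqsl2 q →ₗ[k] Uqsl2 q :=
  (MulOpposite.opLinearEquiv k).symm.toLinearMap ∘ₗ (antipodeHom q).toLinearMap

theorem antipodeLin_apply {k : Type u} [Field k] (q : k) (a : Uqsl2 q) :
    antipodeLin q a = MulOpposite.unop (antipodeHom q a) := rfl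

theorem antipodeLin_mul {k : Type u} [Field k] (q : k) (a b : Uqsl2 q) :
    antipodeLin q (a * b) = antipodeLin q b * antipodeLin q a := by
  simp [antipodeLin_apply]

theorem mul_rTensor_antipode_mul {k : Type u} [Field k] (q : k) (c : k)
    (x y : Uqsl2 q ⊗[k] Uqsl2 q)
    (hx : LinearMap.mul' k (Uqsl2 q) ((antipodeLin q).rTensor (Uqsl2 q) x)
      = algebraMap k (Uqsl2 q) c) :
    LinearMap.mul' k (Uqsl2 q) ((antipodeLin q).rTensor (Uqsl2 q) (x * y))
      = c • LinearMap.mul' k (Uqsl2 q) ((antipodeLin q).rTensor (Uqsl2 q) y) := by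
  induction y using TensorProduct.induction_on with
  | zero => simp
  | add y z hy hz => simp only [mul_add, map_add, hy, hz, smul_add]
  | tmul a b =>
    have key : ∀ x : Uqsl2 q ⊗[k] Uqsl2 q,
        LinearMap.mul' k (Uqsl2 q) ((antipodeLin q).rTensor (Uqsl2 q) (x * a ⊗ₜ[k] b))
          = antipodeLin q a
            * LinearMap.mul' k (Uqsl2 q) ((antipodeLin q).rTensor (Uqsl2 q) x) * b := by
      intro x
      induction x using TensorProduct.induction_on with
      | zero => simp
      | add y z hy hz => simp only [add_mul, mul_add, map_add, hy, hz]
      | tmul r s =>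
        simp only [Algebra.TensorProduct.tmul_mul_tmul, LinearMap.rTensor_tmul,
          LinearMap.mul'_apply, antipodeLin_mul, mul_assoc]
    rw [key, hx, ← Algebra.commutes, Algebra.smul_def, LinearMap.rTensor_tmul,
      LinearMap.mul'_apply, mul_assoc]

theorem mul_lTensor_antipode_mul {k : Type u} [Field k] (q : k) (c : k)
    (x y : Uqsl2 q ⊗[k] Uqsl2 q)
    (hy : LinearMap.mul' k (Uqsl2 q) ((antipodeLin q).lTensor (Uqsl2 q) y)
      = algebraMap k (Uqsl2 q) c) :
    LinearMap.mul' k (Uqsl2 q) ((antipodeLin q).lTensor (Uqsl2 q) (x * y))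
      = c • LinearMap.mul' k (Uqsl2 q) ((antipodeLin q).lTensor (Uqsl2 q) x) := by
  induction x using TensorProduct.induction_on with
  | zero => simp
  | add y z hy hz => simp only [add_mul, map_add, hy, hz, smul_add]
  | tmul a b =>
    have key : ∀ y : Uqsl2 q ⊗[k] Uqsl2 q,
        LinearMap.mul' k (Uqsl2 q) ((antipodeLin q).lTensor (Uqsl2 q) (a ⊗ₜ[k] b * y))
          = a * LinearMap.mul' k (Uqsl2 q) ((antipodeLin q).lTensor (Uqsl2 q) y)
            * antipodeLin q b := by
      intro y
      induction y using TensorProduct.induction_on with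
      | zero => simp
      | add y z hy hz => simp only [add_mul, mul_add, map_add, hy, hz]
      | tmul r s =>
        simp only [Algebra.TensorProduct.tmul_mul_tmul, LinearMap.lTensor_tmul,
          LinearMap.mul'_apply, antipodeLin_mul, mul_assoc]
    rw [key, hy, ← Algebra.commutes, Algebra.smul_def, LinearMap.lTensor_tmul,
      LinearMap.mul'_apply, mul_assoc]

theorem mul_rTensor_antipode_comul {k : Type u} [Field k] (q : k) (a : Uqsl2 q) :
    LinearMap.mul' k (Uqsl2 q) ((antipodeLin q).rTensor (Uqsl2 q) (comulHom q a))
      = algebraMap k (Uqsl2 q) (counitHom q a) := by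
  have ha : a ∈ Algebra.adjoin k ({E q, F q, K q, Kinv q} : Set (Uqsl2 q)) := by
    rw [adjoin_generators]; trivial
  induction ha using Algebra.adjoin_induction with
  | mem x hx =>
    rcases hx with rfl | rfl | rfl | rfl
    · simp [comulHom_E, counitHom_E, antipodeLin_apply, antipodeHom_E, antipodeHom_K]
    · simp [comulHom_F, counitHom_F, antipodeLin_apply, antipodeHom_F, mul_assoc, K_mul_Kinv]
    · simp [comulHom_K, counitHom_K, antipodeLin_apply, antipodeHom_K, Kinv_mul_K]
    · simp [comulHom_Kinv, counitHom_Kinv, antipodeLin_apply, antipodeHom_Kinv, K_mul_Kinv]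
  | algebraMap r =>
    rw [AlgHom.commutes, AlgHom.commutes, Algebra.algebraMap_eq_smul_one (A := Uqsl2 q ⊗[k] Uqsl2 q)]
    simp [Algebra.TensorProduct.one_def, antipodeLin_apply, Algebra.algebraMap_eq_smul_one]
  | add x y _ _ hx hy => simp only [map_add, hx, hy]
  | mul x y _ _ hx hy =>
    rw [map_mul, mul_rTensor_antipode_mul q _ _ _ hx, hy, map_mul, map_mul, Algebra.smul_def]

theorem mul_lTensor_antipode_comul {k : Type u} [Field k] (q : k) (a : Uqsl2 q) :
    LinearMap.mul' k (Uqsl2 q) ((antipodeLin q).lTensor (Uqsl2 q) (comulHom q a))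
      = algebraMap k (Uqsl2 q) (counitHom q a) := by
  have ha : a ∈ Algebra.adjoin k ({E q, F q, K q, Kinv q} : Set (Uqsl2 q)) := by
    rw [adjoin_generators]; trivial
  induction ha using Algebra.adjoin_induction with
  | mem x hx =>
    rcases hx with rfl | rfl | rfl | rfl
    · simp [comulHom_E, counitHom_E, antipodeLin_apply, antipodeHom_E, ← mul_assoc, K_mul_Kinv]
    · simp [comulHom_F, counitHom_F, antipodeLin_apply, antipodeHom_F, antipodeHom_Kinv]
    · simp [comulHom_K, counitHom_K, antipodeLin_apply, antipodeHom_K, K_mul_Kinv]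
    · simp [comulHom_Kinv, counitHom_Kinv, antipodeLin_apply, antipodeHom_Kinv, Kinv_mul_K]
  | algebraMap r =>
    rw [AlgHom.commutes, AlgHom.commutes, Algebra.algebraMap_eq_smul_one (A := Uqsl2 q ⊗[k] Uqsl2 q)]
    simp [Algebra.TensorProduct.one_def, antipodeLin_apply, Algebra.algebraMap_eq_smul_one]
  | add x y _ _ hx hy => simp only [map_add, hx, hy]
  | mul x y _ _ hx hy =>
    rw [map_mul, mul_lTensor_antipode_mul q _ _ _ hy, hx, map_mul, map_mul, Algebra.smul_def,
      Algebra.commutes]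

/-- `U_q(sl_2)` is a Hopf algebra. -/
noncomputable instance instHopfAlgebra {k : Type u} [Field k] (q : k) :
    HopfAlgebra k (Uqsl2 q) where
  antipode := antipodeLin q
  mul_antipode_rTensor_comul := LinearMap.ext (mul_rTensor_antipode_comul q)
  mul_antipode_lTensor_comul := LinearMap.ext (mul_lTensor_antipode_comul q)

/-- The standard Borel subalgebra `U^{≥0}`, generated by `E`, `K`, `K⁻¹`. -/
noncomputable def nonnegPart {k : Type u} [Field k] (q : k) : Subalgebra k (Uqsl2 q) :=
  Algebra.adjoin k {E q, K q, Kinv q}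

/-- The standard Borel subalgebra `U^{≤0}`, generated by `F`, `K`, `K⁻¹`. -/
noncomputable def nonposPart {k : Type u} [Field k] (q : k) : Subalgebra k (Uqsl2 q) :=
  Algebra.adjoin k {F q, K q, Kinv q}

/-- The subalgebra `B_{s,t}` generated by `E K⁻¹ + s K⁻¹` and `F + t K⁻¹`. -/
noncomputable def shiftedPart {k : Type u} [Field k] (q s t : k) : Subalgebra k (Uqsl2 q) :=
  Algebra.adjoin k {E q * Kinv q + s • Kinv q, F q + t • Kinv q}

end Uqsl2

/-! ### Right coideal subalgebras, basic algebras and Borel subalgebras -/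

/-- A subalgebra `C` of a Hopf algebra `H` is a right coideal subalgebra if `Δ(C) ⊆ C ⊗ H`,
where `C ⊗ H` is regarded as a subspace of `H ⊗ H`. -/
def IsRightCoidealSubalgebra {k : Type u} [Field k] {H : Type v} [Ring H] [HopfAlgebra k H]
    (C : Subalgebra k H) : Prop :=
  ∀ c ∈ C, Coalgebra.comul (R := k) c ∈
    LinearMap.range (LinearMap.rTensor H (Subalgebra.toSubmodule C).subtype)

/-- A `k`-algebra is basic if all its finite-dimensional irreducible representations are
one-dimensional. -/
def IsBasicAlgebra (k : Type u) [Field k] (A : Type v) [Ring A] [Algebra k A] : Prop :=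
  ∀ (V : Type v) [AddCommGroup V] [Module k V] [Module A V] [IsScalarTower k A V]
    [FiniteDimensional k V] [IsSimpleModule A V], Module.finrank k V = 1

/-- A Borel subalgebra is a basic right coideal subalgebra that is maximal with respect to
inclusion among all basic right coideal subalgebras. -/
def IsBorelSubalgebra {k : Type u} [Field k] {H : Type v} [Ring H] [HopfAlgebra k H]
    (B : Subalgebra k H) : Prop :=
  Maximal (fun C : Subalgebra k H => IsRightCoidealSubalgebra C ∧ IsBasicAlgebra k C) B

/-! Everything is read off from the two-dimensional irreducible representation of `U`. A basic
subalgebra `C` cannot act irreducibly on it, so `C` stabilizes a line `k w` (`exists_stabilizes`).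
If `C` is moreover a right coideal subalgebra, the first tensor factors of `Δ(c)` lie in `C`, so the
image of `Δ(c)` in `M₂(U)` sends `w` into `w ⊗ U` (`Stabilizes.exists_coact_eq`). Thus `C` lies in
the kernel of one explicit linear map `U → U` that depends only on the line.

After rescaling, `w` is `(1, 0)`, `(0, 1)` or `(1, b)` with `b ≠ 0`. In each case a PBW basis
adapted to `w` makes the linear map monomial: basis vectors go to multiples of vectors of an
independent family, without collisions where the coefficient is nonzero. Its kernel is therefore
spanned by the basis vectors with coefficient zero. These lie in `U^{≥0}`, in `U^{≤0}`, or in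
`B_{s,t}` with `s`, `t` determined by `b`. So every basic right coideal subalgebra is contained in a
listed one (`stabilizes_and_le_of_isBasicAlgebra`).

The listed algebras are basic because their generators have a common eigenvector in every nonzero
finite-dimensional representation. For `U^{≥0}` and `U^{≤0}` a determinant argument gives `E` or `F`
a kernel, on which `K` acts. For `B_{s,t}` the condition on `s t` turns the defining relation into
that of a quantum Weyl algebra, whose commutator is singular by a similar argument.

Maximality holds because different listed algebras do not share a line of the types above: a basic
coideal subalgebra containing a listed one has the same line, hence is contained in the same listed
algebra. -/

/-! ### Linear algebra: monomial maps and triangular families. -/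

/-- Images of distinct `b p` with `c p ≠ 0` are multiples of distinct independent vectors, so they
cannot cancel. Injectivity of `σ` is needed only there, which leaves room for truncated subtraction
in the exponents. -/
theorem LinearMap.ker_le_span_of_apply_eq_smul {k M N ι κ : Type*} [Field k] [AddCommGroup M]
    [Module k M] [AddCommGroup N] [Module k N] {b : ι → M} (hb : Submodule.span k (Set.range b) = ⊤)
    {w : κ → N} (hw : LinearIndependent k w) (Φ : M →ₗ[k] N) (c : ι → k) (σ : ι → κ)
    (hσ : Set.InjOn σ {p | c p ≠ 0}) (hΦ : ∀ p, Φ (b p) = c p • w (σ p)) :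
    LinearMap.ker Φ ≤ Submodule.span k (b '' {p | c p = 0}) := by
  classical
  intro m hm
  have hmt : m ∈ Submodule.span k (Set.range b) := hb ▸ Submodule.mem_top
  obtain ⟨l, rfl⟩ := Finsupp.mem_span_range_iff_exists_finsupp.1 hmt
  rw [LinearMap.mem_ker, Finsupp.sum, map_sum] at hm
  have hw' := (hw.comp (fun p : {p // c p ≠ 0} => σ p) (fun p p' h => Subtype.ext (hσ p.2 p'.2 h)))
  rw [Finsupp.sum]
  have key : ∀ p ∈ l.support, c p = 0 := by
    intro p hp
    by_contra hcp
    have h0 : ∑ x ∈ l.support.filter (fun p => c p ≠ 0), (l x * c x) • w (σ x) = 0 := by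
      rw [← hm, Finset.sum_filter]
      refine Finset.sum_congr rfl fun x _ => ?_
      rw [map_smul, hΦ, smul_smul]
      split_ifs with h
      · rfl
      · rw [not_not.1 h, mul_zero, zero_smul]
    rw [← Finset.sum_subtype_of_mem (p := fun p => c p ≠ 0) _
      (fun x hx => (Finset.mem_filter.1 hx).2)] at h0
    have := linearIndependent_iff'.1 hw' _ (fun x => l x.1 * c x.1) h0 ⟨p, hcp⟩
      (by simp [hcp] at hp ⊢; exact hp)
    rcases mul_eq_zero.1 this with h | h
    · exact (Finsupp.mem_support_iff.1 hp) h
    · exact hcp h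
  exact Submodule.sum_mem _ fun p hp =>
    Submodule.smul_mem _ _ (Submodule.subset_span ⟨p, key p hp, rfl⟩)

/-- Unitriangularity: in a linear relation, look at the coordinate `p` of maximal degree in the
support. No other `f p'` in the relation contributes there. -/
theorem linearIndependent_of_sub_single_mem_supported {k ι : Type*} [Field k] (deg : ι → ℕ)
    (f : ι → ι →₀ k)
    (hf : ∀ p, f p - Finsupp.single p 1 ∈ Finsupp.supported k k {p' | deg p' < deg p}) :
    LinearIndependent k f := by
  classical
  rw [linearIndependent_iff]
  intro l hl
  by_contra h0
  obtain ⟨p, hp, hmax⟩ := Finset.exists_max_image l.support deg (Finsupp.support_nonempty_iff.2 h0)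
  have h1 : ∀ p' ∈ l.support, f p' p = Finsupp.single p' (1 : k) p := by
    intro p' hp'
    have h2 := (Finsupp.mem_supported' _ _).1 (hf p') p (by simpa using hmax p' hp')
    rwa [Finsupp.sub_apply, sub_eq_zero] at h2
  have h2 := DFunLike.congr_fun hl p
  rw [Finsupp.linearCombination_apply, Finsupp.sum, Finsupp.finsetSum_apply] at h2
  rw [Finset.sum_congr rfl (fun p' hp' => by rw [Finsupp.smul_apply, h1 p' hp'])] at h2
  rw [Finset.sum_eq_single_of_mem p hp (fun p' _ hne => by
    rw [Finsupp.single_eq_of_ne hne.symm, smul_zero])] at h2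
  simp at h2
  exact (Finsupp.mem_support_iff.1 hp) h2

/-! ### Common eigenvectors of q-commuting operators. -/

section Representations

variable {k : Type u} [Field k] {V : Type v} [AddCommGroup V] [Module k V] [FiniteDimensional k V]

/-- Determinants turn the relation into `det a = r ^ dim V * det a`, since `det g` is invertible. -/
theorem LinearMap.det_eq_zero_of_mul_eq_smul_mul [Nontrivial V] {r : k}
    (hr : ∀ n : ℕ, 0 < n → r ^ n ≠ 1) {a g : Module.End k V} (hg : IsUnit g)
    (h : g * a = r • (a * g)) : LinearMap.det a = 0 := by
  have h1 := congrArg LinearMap.det h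
  rw [map_mul, LinearMap.det_smul, map_mul] at h1
  have h2 : LinearMap.det g ≠ 0 := (hg.map LinearMap.det).ne_zero
  by_contra h3
  refine hr (Module.finrank k V) Module.finrank_pos ?_
  apply mul_right_cancel₀ (mul_ne_zero h3 h2)
  rw [one_mul, ← h1, mul_comm]

theorem Module.End.exists_mem_eq_smul [IsAlgClosed k] (W : Submodule k V) (hW : W ≠ ⊥)
    (g : Module.End k V) (hg : ∀ w ∈ W, g w ∈ W) : ∃ w ∈ W, w ≠ 0 ∧ ∃ μ : k, g w = μ • w := by
  have : Nontrivial W := (Submodule.nontrivial_iff_ne_bot).2 hW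
  obtain ⟨μ, hμ⟩ := Module.End.exists_eigenvalue (g.restrict hg)
  obtain ⟨w, hw⟩ := hμ.exists_hasEigenvector
  refine ⟨w, w.2, fun h => hw.2 (Subtype.ext h), μ, ?_⟩
  exact congrArg Subtype.val hw.apply_eq_smul

theorem LinearMap.det_one_add_mul_comm (f g : Module.End k V) :
    LinearMap.det (1 + f * g) = LinearMap.det (1 + g * f) := by
  let b := Module.finBasis k V
  rw [← LinearMap.det_toMatrix b, ← LinearMap.det_toMatrix b, map_add, map_add,
    LinearMap.toMatrix_mul, LinearMap.toMatrix_mul, LinearMap.toMatrix_one,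
    Matrix.det_one_add_mul_comm]

/-- Two operators with `g a = r a g`, where `g` is invertible and `r` is not a root of unity, have
a common eigenvector. -/
theorem Module.End.exists_common_eigenvector_of_mul_eq_smul_mul [IsAlgClosed k] [Nontrivial V]
    {r : k} (hr0 : r ≠ 0) (hr : ∀ n : ℕ, 0 < n → r ^ n ≠ 1) {a g : Module.End k V} (hg : IsUnit g)
    (h : g * a = r • (a * g)) : ∃ w : V, w ≠ 0 ∧ a w = 0 ∧ ∃ μ : k, g w = μ • w := by
  have hd := LinearMap.bot_lt_ker_of_det_eq_zero (LinearMap.det_eq_zero_of_mul_eq_smul_mul hr hg h)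
  obtain ⟨w, hw, hw0, hμ⟩ := Module.End.exists_mem_eq_smul (LinearMap.ker a) hd.ne' g (by
    intro w hw
    have h1 := LinearMap.congr_fun h w
    rw [LinearMap.mem_ker] at hw ⊢
    simp only [Module.End.mul_apply, LinearMap.smul_apply, hw, map_zero] at h1
    exact (smul_eq_zero.1 h1.symm).resolve_left hr0)
  exact ⟨w, hw0, hw, hμ⟩

/-- In a finite-dimensional representation of the quantum Weyl algebra `x y - r y x = c`, with
`c ≠ 0` and `r` not a root of unity, the generators have a common eigenvector. -/
theorem Module.End.exists_common_eigenvector_of_quantumWeyl [IsAlgClosed k] [Nontrivial V]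
    {r c : k} (hr0 : r ≠ 0) (hr : ∀ n : ℕ, 0 < n → r ^ n ≠ 1) (hc : c ≠ 0) {x y : Module.End k V}
    (h : x * y = r • (y * x) + c • 1) :
    ∃ w : V, w ≠ 0 ∧ (∃ μ : k, x w = μ • w) ∧ ∃ μ : k, y w = μ • w := by
  set z : Module.End k V := x * y - y * x with hz
  -- The relation writes `z` and `r • z` as `c` times `1 + f * g` and `1 + g * f` for the same `f`,
  -- `g`. Their determinants agree, so `r ^ dim V * det z = det z` and `z` is singular.
  have h1 : z = c • (1 + (((r - 1) / c) • y) * x) := by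
    rw [hz, h, smul_add, smul_mul_assoc, smul_smul, mul_div_cancel₀ _ hc, sub_smul, one_smul]
    abel
  have h2 : r • z = c • (1 + x * (((r - 1) / c) • y)) := by
    rw [hz, mul_smul_comm, smul_add, smul_smul, mul_div_cancel₀ _ hc, smul_sub, sub_smul, one_smul]
    nth_rewrite 3 [h]
    abel
  have hdz : LinearMap.det z = 0 := by
    have h3 : LinearMap.det (r • z) = LinearMap.det z := by
      rw [h2, h1, LinearMap.det_smul, LinearMap.det_smul, LinearMap.det_one_add_mul_comm]
    rw [LinearMap.det_smul] at h3
    by_contra h4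
    exact hr _ Module.finrank_pos (mul_right_cancel₀ h4 (h3.trans (one_mul _).symm))
  -- The commutator `z` commutes with `x` and `y` up to powers of `r`, so `ker z` is stable under
  -- both.
  have hzx : x * z = r • (z * x) := by
    calc x * z = x * (x * y) - x * y * x := by rw [hz]; noncomm_ring
      _ = x * (r • (y * x) + c • 1) - (r • (y * x) + c • 1) * x := by rw [h]
      _ = r • (z * x) := by
        simp only [hz, mul_add, add_mul, sub_mul, mul_smul_comm, smul_mul_assoc, mul_one, one_mul,
          smul_sub, mul_assoc]
        abel
  have hzy : z * y = r • (y * z) := by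
    calc z * y = x * y * y - y * (x * y) := by rw [hz]; noncomm_ring
      _ = (r • (y * x) + c • 1) * y - y * (r • (y * x) + c • 1) := by rw [h]
      _ = r • (y * z) := by
        simp only [hz, mul_add, add_mul, mul_sub, mul_smul_comm, smul_mul_assoc, mul_one, one_mul,
          smul_sub, mul_assoc]
        abel
  have hxk : ∀ w ∈ LinearMap.ker z, x w ∈ LinearMap.ker z := by
    intro w hw
    have h1 := LinearMap.congr_fun hzx w
    rw [LinearMap.mem_ker] at hw ⊢
    simp only [Module.End.mul_apply, LinearMap.smul_apply, hw, map_zero] at h1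
    exact (smul_eq_zero.1 h1.symm).resolve_left hr0
  have hyk : ∀ w ∈ LinearMap.ker z, y w ∈ LinearMap.ker z := by
    intro w hw
    have h1 := LinearMap.congr_fun hzy w
    rw [LinearMap.mem_ker] at hw ⊢
    simpa only [Module.End.mul_apply, LinearMap.smul_apply, hw, map_zero, smul_zero] using h1
  -- On `ker z` the operators `x` and `y` commute, so `y` preserves the eigenspaces of `x` there.
  obtain ⟨w₁, hw₁, hw₁0, μ, hμ⟩ := Module.End.exists_mem_eq_smul _
    (LinearMap.bot_lt_ker_of_det_eq_zero hdz).ne' x hxk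
  obtain ⟨w, hw, hw0, hν⟩ := Module.End.exists_mem_eq_smul
    (LinearMap.ker z ⊓ Module.End.eigenspace x μ)
    (fun hbot => hw₁0 ((Submodule.mem_bot k).1
      (hbot ▸ ⟨hw₁, Module.End.mem_eigenspace_iff.2 hμ⟩))) y (by
    rintro w ⟨hwz, hwx⟩
    refine ⟨hyk w hwz, Module.End.mem_eigenspace_iff.2 ?_⟩
    have h5 : x (y w) - y (x w) = 0 := hwz
    rw [sub_eq_zero.1 h5, Module.End.mem_eigenspace_iff.1 hwx, map_smul])
  exact ⟨w, hw0, ⟨μ, Module.End.mem_eigenspace_iff.1 hw.2⟩, hν⟩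

end Representations

/-- The sum `1 + r + ⋯ + r ^ (n - 1)`. -/
def geomSum {k : Type u} [Field k] (r : k) (n : ℕ) : k := ∑ i ∈ Finset.range n, r ^ i

theorem geomSum_zero {k : Type u} [Field k] (r : k) : geomSum r 0 = 0 := by simp [geomSum]

theorem geomSum_succ {k : Type u} [Field k] (r : k) (n : ℕ) :
    geomSum r (n + 1) = r * geomSum r n + 1 := by
  rw [geomSum, geom_sum_succ, geomSum]

theorem geomSum_ne_zero {k : Type u} [Field k] {r : k} (hr : ∀ n : ℕ, 0 < n → r ^ n ≠ 1) {n : ℕ}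
    (hn : n ≠ 0) : geomSum r n ≠ 0 := by
  intro h
  have h1 := geom_sum_mul r n
  rw [← geomSum, h, zero_mul] at h1
  exact hr n (Nat.pos_of_ne_zero hn) (sub_eq_zero.1 h1.symm)

namespace Uqsl2

/-! ### The regular representation in coordinates -/

section Regular

variable {k : Type u} [Field k] (q : k)

/-- Multiplication by `K` in the coordinates of the basis `K ^ n F ^ i (E K⁻¹) ^ j`. -/
noncomputable def regK (k : Type u) [Field k] (m : ℤ) : Module.End k (ℤ × ℕ × ℕ →₀ k) :=
  Finsupp.linearCombination k fun p => Finsupp.single (p.1 + m, p.2) 1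

/-- Multiplication by `F` in the coordinates of the basis `K ^ n F ^ i (E K⁻¹) ^ j`. -/
noncomputable def regF : Module.End k (ℤ × ℕ × ℕ →₀ k) :=
  Finsupp.linearCombination k fun p =>
    (q ^ (2 * p.1)) • Finsupp.single (p.1, p.2.1 + 1, p.2.2) 1

/-- Multiplication by `E` in the coordinates of the basis `K ^ n F ^ i (E K⁻¹) ^ j`. -/
noncomputable def regE : Module.End k (ℤ × ℕ × ℕ →₀ k) :=
  Finsupp.linearCombination k fun p =>
    (q ^ (-2 * p.1)) • ((q ^ (2 * (p.2.1 : ℤ) - 2)) • Finsupp.single (p.1 + 1, p.2.1, p.2.2 + 1) 1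
      + (q - q⁻¹)⁻¹ • (geomSum (q ^ 2) p.2.1 • Finsupp.single (p.1 + 1, p.2.1 - 1, p.2.2) 1
        - geomSum (q ^ 2)⁻¹ p.2.1 • Finsupp.single (p.1 - 1, p.2.1 - 1, p.2.2) 1))

theorem regK_single (m n : ℤ) (ij : ℕ × ℕ) :
    regK k m (Finsupp.single (n, ij) 1) = Finsupp.single (n + m, ij) 1 := by
  simp [regK]

theorem regF_single (n : ℤ) (i j : ℕ) :
    regF q (Finsupp.single (n, i, j) 1) = q ^ (2 * n) • Finsupp.single (n, i + 1, j) 1 := by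
  simp [regF]

/-- The first coefficient comes from `E = q⁻² K (E K⁻¹)` and `F ^ i K = q ^ (2 i) K F ^ i`. The
other two come from the commutator of `E` with `F ^ i`. For `i = 0` the truncated index `i - 1` is
harmless, as its coefficient is `geomSum _ 0 = 0`. -/
theorem regE_single (n : ℤ) (i j : ℕ) :
    regE q (Finsupp.single (n, i, j) 1) =
      (q ^ (-2 * n)) • ((q ^ (2 * (i : ℤ) - 2)) • Finsupp.single (n + 1, i, j + 1) 1
      + (q - q⁻¹)⁻¹ • (geomSum (q ^ 2) i • Finsupp.single (n + 1, i - 1, j) 1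
        - geomSum (q ^ 2)⁻¹ i • Finsupp.single (n - 1, i - 1, j) 1)) := by
  rw [regE, Finsupp.linearCombination_single, one_smul]

theorem regK_mul_regK {m m' : ℤ} (h : m + m' = 0) : regK k m * regK k m' = 1 := by
  ext ⟨n, ij⟩ : 2
  simp [regK_single, add_assoc, add_comm m' m, h]

theorem regK_mul_regE (hq : q ≠ 0) : regK k 1 * regE q = q ^ 2 • (regE q * regK k 1) := by
  ext ⟨n, i, j⟩ : 2
  simp only [LinearMap.comp_apply, Finsupp.lsingle_apply, Module.End.mul_apply, regK_single,
    regE_single, map_smul, map_add, map_sub, LinearMap.smul_apply, smul_smul]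
  rw [← zpow_natCast q 2, ← zpow_add₀ hq]
  congr 1
  · congr 1; push_cast; ring
  · simp

theorem regF_mul_regK (hq : q ≠ 0) : regF q * regK k 1 = q ^ 2 • (regK k 1 * regF q) := by
  ext ⟨n, i, j⟩ : 2
  simp only [LinearMap.comp_apply, Finsupp.lsingle_apply, Module.End.mul_apply, regK_single,
    regF_single, map_smul, LinearMap.smul_apply, smul_smul]
  rw [← zpow_natCast q 2, ← zpow_add₀ hq]
  congr 1
  congr 1; push_cast; ring

theorem regE_mul_regF (hq : q ≠ 0) :
    regE q * regF q - regF q * regE q = (q - q⁻¹)⁻¹ • (regK k 1 - regK k (-1)) := by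
  have h2 : q ^ (2 : ℤ) = q ^ 2 := by norm_cast
  have hq2 : ∀ n : ℤ, q ^ (2 * n) ≠ 0 := fun n => zpow_ne_zero _ hq
  ext ⟨n, i, j⟩ : 2
  -- The split makes `i - 1` a genuine predecessor whenever its coefficient survives.
  rcases i with _ | i
  · simp only [LinearMap.comp_apply, Finsupp.lsingle_apply, Module.End.mul_apply, regK_single,
      regF_single, regE_single, map_smul, LinearMap.smul_apply,
      LinearMap.sub_apply, geomSum_zero, geomSum_succ, zero_smul, smul_zero,
      sub_zero, add_zero, mul_zero, zero_add, ← sub_eq_add_neg]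
    match_scalars
    all_goals generalize (q - q⁻¹)⁻¹ = c
    all_goals simp only [neg_mul, zpow_neg, mul_add, zpow_add₀ hq, zpow_sub₀ hq, mul_one, h2]
    all_goals have := hq2 n
    all_goals field_simp
    simp
  · simp only [LinearMap.comp_apply, Finsupp.lsingle_apply, Module.End.mul_apply, regK_single,
      regF_single, regE_single, map_smul, map_add, map_sub, LinearMap.smul_apply,
      LinearMap.sub_apply, geomSum_succ, Nat.add_sub_cancel, ← sub_eq_add_neg]
    match_scalars
    all_goals generalize (q - q⁻¹)⁻¹ = c
    all_goals simp only [neg_mul, zpow_neg, mul_add, mul_sub, zpow_add₀ hq, zpow_sub₀ hq, mul_one, h2]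
    all_goals have := hq2 n
    all_goals field_simp
    all_goals ring

/-! ### Degree filtration and independence of the PBW families. -/

/-- The span of the coordinate vectors of total degree less than `d` in `E` and `F`. -/
abbrev regFil (k : Type u) [Field k] (d : ℕ) : Submodule k (ℤ × ℕ × ℕ →₀ k) :=
  Finsupp.supported k k {p | p.2.1 + p.2.2 < d}

theorem single_mem_regFil {d : ℕ} (p : ℤ × ℕ × ℕ) (h : p.2.1 + p.2.2 < d) :
    Finsupp.single p 1 ∈ regFil k d := Finsupp.single_mem_supported k 1 h

theorem regFil_mono {d d' : ℕ} (h : d ≤ d') : regFil k d ≤ regFil k d' :=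
  Finsupp.supported_mono fun _ hp => lt_of_lt_of_le hp h

theorem map_mem_regFil {d d' : ℕ} (T : Module.End k (ℤ × ℕ × ℕ →₀ k))
    (hT : ∀ n i j, i + j < d → T (Finsupp.single (n, i, j) 1) ∈ regFil k d')
    {w : ℤ × ℕ × ℕ →₀ k} (hw : w ∈ regFil k d) : T w ∈ regFil k d' := by
  rw [regFil, Finsupp.supported_eq_span_single] at hw
  induction hw using Submodule.span_induction with
  | mem x hx => obtain ⟨⟨n, i, j⟩, hp, rfl⟩ := hx; exact hT n i j hp
  | zero => rw [map_zero]; exact Submodule.zero_mem _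
  | add x y _ _ hx hy => rw [map_add]; exact Submodule.add_mem _ hx hy
  | smul a x _ hx => rw [map_smul]; exact Submodule.smul_mem _ a hx

theorem regK_mem_regFil {d : ℕ} (m : ℤ) {w : ℤ × ℕ × ℕ →₀ k} (hw : w ∈ regFil k d) :
    regK k m w ∈ regFil k d :=
  map_mem_regFil _ (fun n i j h => by rw [regK_single]; exact single_mem_regFil _ h) hw

theorem regF_mem_regFil {d : ℕ} {w : ℤ × ℕ × ℕ →₀ k} (hw : w ∈ regFil k d) :
    regF q w ∈ regFil k (d + 1) :=
  map_mem_regFil _ (fun n i j h => by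
    rw [regF_single]
    exact Submodule.smul_mem _ _ (single_mem_regFil _ (by dsimp only; omega))) hw

theorem regE_mem_regFil {d : ℕ} {w : ℤ × ℕ × ℕ →₀ k} (hw : w ∈ regFil k d) :
    regE q w ∈ regFil k (d + 1) :=
  map_mem_regFil _ (fun n i j h => by
    rw [regE_single]
    refine Submodule.smul_mem _ _ (Submodule.add_mem _ ?_
      (Submodule.smul_mem _ _ (Submodule.sub_mem _ ?_ ?_))) <;>
    exact Submodule.smul_mem _ _ (single_mem_regFil _ (by dsimp only; omega))) hw

/-- The regular representation in coordinates. -/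
noncomputable def regRep (hq : q ≠ 0) : Uqsl2 q →ₐ[k] Module.End k (ℤ × ℕ × ℕ →₀ k) :=
  lift q (regE q) (regF q) (regK k 1) (regK k (-1)) (regK_mul_regK (by norm_num))
    (regK_mul_regK (by norm_num)) (regK_mul_regE q hq) (regF_mul_regK q hq) (regE_mul_regF q hq)

/-- The element `K` as a unit. -/
noncomputable def Kunit : (Uqsl2 q)ˣ := ⟨K q, Kinv q, K_mul_Kinv q, Kinv_mul_K q⟩

/-- The integral powers of `K`. -/
noncomputable def Kpow (n : ℤ) : Uqsl2 q := ((Kunit q ^ n : (Uqsl2 q)ˣ) : Uqsl2 q)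

theorem Kpow_zero : Kpow q 0 = 1 := by simp [Kpow]

theorem Kpow_one : Kpow q 1 = K q := by simp [Kpow, Kunit]

theorem Kpow_neg_one : Kpow q (-1) = Kinv q := by simp [Kpow, Kunit]

theorem Kpow_add (m n : ℤ) : Kpow q (m + n) = Kpow q m * Kpow q n := by
  simp [Kpow, zpow_add]

/-- Induction on the powers of `K`. -/
@[elab_as_elim]
theorem Kpow_induction {P : ℤ → Prop} (zero : P 0) (succ : ∀ n, P n → P (1 + n))
    (pred : ∀ n, P n → P (-1 + n)) (n : ℤ) : P n := by
  induction n using Int.induction_on with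
  | zero => exact zero
  | succ n ih => rw [add_comm]; exact succ _ ih
  | pred n ih => rw [sub_eq_neg_add]; exact pred _ ih

/-- The element `F + t K⁻¹`. -/
noncomputable def shiftF (t : k) : Uqsl2 q := F q + t • Kinv q

/-- The element `E K⁻¹ + s K⁻¹`. -/
noncomputable def shiftE (s : k) : Uqsl2 q := E q * Kinv q + s • Kinv q

/-- The family `K ^ n (F + t K⁻¹) ^ i (E K⁻¹ + s K⁻¹) ^ j`. -/
noncomputable def pbw (s t : k) (p : ℤ × ℕ × ℕ) : Uqsl2 q :=
  Kpow q p.1 * (shiftF q t ^ p.2.1 * shiftE q s ^ p.2.2)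

variable {q}

theorem regRep_Kpow (hq : q ≠ 0) (n : ℤ) : regRep q hq (Kpow q n) = regK k n := by
  have h : ∀ a b, regK k (a + b) = regK k a * regK k b := by
    intro a b
    ext ⟨n, ij⟩ : 2
    simp [regK_single, add_assoc, add_comm a b]
  refine Kpow_induction ?_ (fun n ih => ?_) (fun n ih => ?_) n
  · rw [Kpow_zero, map_one]
    ext ⟨n, ij⟩ : 2
    simp [regK_single]
  · rw [Kpow_add, map_mul, ih, Kpow_one, h, regRep, lift_K]
  · rw [Kpow_add, map_mul, ih, Kpow_neg_one, h, regRep, lift_Kinv]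

theorem regRep_shiftF (hq : q ≠ 0) (t : k) :
    regRep q hq (shiftF q t) = regF q + t • regK k (-1) := by
  rw [shiftF, map_add, map_smul, regRep, lift_F, lift_Kinv]

theorem regRep_shiftE (hq : q ≠ 0) (s : k) :
    regRep q hq (shiftE q s) = regE q * regK k (-1) + s • regK k (-1) := by
  rw [shiftE, map_add, map_smul, map_mul, regRep, lift_E, lift_Kinv]

/-- The summand `s K⁻¹` preserves degree while `E K⁻¹` raises it by one, so `s` affects only
lower-order terms. -/
theorem regRep_shiftE_pow_sub_mem (hq : q ≠ 0) (s : k) (j : ℕ) :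
    regRep q hq (shiftE q s ^ j) (Finsupp.single (0, 0, 0) 1) - Finsupp.single (0, 0, j) 1
      ∈ regFil k j := by
  induction j with
  | zero => simp
  | succ j ih =>
    rw [pow_succ', map_mul, Module.End.mul_apply]
    set w := regRep q hq (shiftE q s ^ j) (Finsupp.single (0, 0, 0) 1)
    have h1 : (Finsupp.single (0, 0, j + 1) 1 : ℤ × ℕ × ℕ →₀ k) =
        regE q (regK k (-1) (Finsupp.single (0, 0, j) 1)) := by
      rw [regK_single, regE_single, geomSum_zero, geomSum_zero]
      simp only [zero_smul, sub_zero, smul_zero, add_zero, smul_smul, ← zpow_add₀ hq]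
      simp
    have hw : w ∈ regFil k (j + 1) := by
      have := Submodule.add_mem _ (regFil_mono (Nat.le_succ j) ih)
        (single_mem_regFil (k := k) (0, 0, j) (d := j + 1) (by simp))
      rwa [sub_add_cancel] at this
    rw [regRep_shiftE, h1, LinearMap.add_apply, Module.End.mul_apply, add_sub_right_comm,
      ← map_sub, ← map_sub]
    exact Submodule.add_mem _ (regE_mem_regFil q (regK_mem_regFil _ ih))
      (Submodule.smul_mem _ _ (regK_mem_regFil _ hw))

theorem regRep_shiftF_pow_mul_sub_mem (hq : q ≠ 0) (s t : k) (i j : ℕ) :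
    regRep q hq (shiftF q t ^ i * shiftE q s ^ j) (Finsupp.single (0, 0, 0) 1)
      - Finsupp.single (0, i, j) 1 ∈ regFil k (i + j) := by
  induction i with
  | zero => simpa using regRep_shiftE_pow_sub_mem hq s j
  | succ i ih =>
    rw [pow_succ', mul_assoc, map_mul, Module.End.mul_apply]
    set w := regRep q hq (shiftF q t ^ i * shiftE q s ^ j) (Finsupp.single (0, 0, 0) 1)
    have h1 : (Finsupp.single (0, i + 1, j) 1 : ℤ × ℕ × ℕ →₀ k) =
        regF q (Finsupp.single (0, i, j) 1) := by
      simp [regF_single]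
    have hw : w ∈ regFil k (i + j + 1) := by
      have := Submodule.add_mem _ (regFil_mono (Nat.le_succ _) ih)
        (single_mem_regFil (k := k) (0, i, j) (d := i + j + 1) (by simp))
      rwa [sub_add_cancel] at this
    rw [regRep_shiftF, h1, LinearMap.add_apply, add_sub_right_comm, ← map_sub, Nat.add_right_comm]
    exact Submodule.add_mem _ (regF_mem_regFil q ih)
      (Submodule.smul_mem _ _ (regK_mem_regFil _ hw))

/-- Applied to the cyclic vector `(0, 0, 0)`, the family becomes unitriangular whatever the shifts
`s`, `t` are. The factor `K ^ n` only translates coordinates and respects the filtration. -/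
theorem linearIndependent_pbw (hq : q ≠ 0) (s t : k) : LinearIndependent k (pbw q s t) := by
  refine LinearIndependent.of_comp
    ((LinearMap.applyₗ (Finsupp.single (0, 0, 0) 1)).comp (regRep q hq).toLinearMap)
    (linearIndependent_of_sub_single_mem_supported (fun p => p.2.1 + p.2.2) _ ?_)
  rintro ⟨n, i, j⟩
  have h := regK_mem_regFil n (regRep_shiftF_pow_mul_sub_mem hq s t i j)
  rw [map_sub, regK_single, zero_add, ← regRep_Kpow hq, ← Module.End.mul_apply, ← map_mul] at h
  exact h

end Regular

/-! ### Commutation relations and spanning by PBW monomials. -/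

section Relations

variable {k : Type u} [Field k] {q : k}

theorem Kinv_mul_E (hq : q ≠ 0) : Kinv q * E q = (q ^ 2)⁻¹ • (E q * Kinv q) := by
  rw [E_mul_Kinv, smul_smul, inv_mul_cancel₀ (pow_ne_zero 2 hq), one_smul]

theorem F_mul_Kinv (hq : q ≠ 0) : F q * Kinv q = (q ^ 2)⁻¹ • (Kinv q * F q) := by
  rw [Kinv_mul_F, smul_smul, inv_mul_cancel₀ (pow_ne_zero 2 hq), one_smul]

theorem F_mul_Kpow (hq : q ≠ 0) (n : ℤ) :
    F q * Kpow q n = ((q ^ 2) ^ n) • (Kpow q n * F q) := by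
  have hq2 : q ^ 2 ≠ 0 := pow_ne_zero 2 hq
  refine Kpow_induction ?_ (fun n ih => ?_) (fun n ih => ?_) n
  · simp [Kpow_zero]
  · rw [Kpow_add, ← mul_assoc, Kpow_one, F_mul_K, smul_mul_assoc, mul_assoc, ih, mul_smul_comm,
      smul_smul, ← mul_assoc, zpow_add₀ hq2, zpow_one]
  · rw [Kpow_add, ← mul_assoc, Kpow_neg_one, F_mul_Kinv hq, smul_mul_assoc, mul_assoc, ih,
      mul_smul_comm, smul_smul, ← mul_assoc, zpow_add₀ hq2, zpow_neg_one]

theorem E_mul_Kpow (hq : q ≠ 0) (n : ℤ) :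
    E q * Kpow q n = ((q ^ 2) ^ (-n)) • (Kpow q n * E q) := by
  have hq2 : q ^ 2 ≠ 0 := pow_ne_zero 2 hq
  have h1 : E q * K q = (q ^ 2)⁻¹ • (K q * E q) := by
    rw [K_mul_E, smul_smul, inv_mul_cancel₀ hq2, one_smul]
  refine Kpow_induction ?_ (fun n ih => ?_) (fun n ih => ?_) n
  · simp [Kpow_zero]
  · rw [Kpow_add, ← mul_assoc, Kpow_one, h1, smul_mul_assoc, mul_assoc, ih, mul_smul_comm,
      smul_smul, ← mul_assoc, neg_add, zpow_add₀ hq2, zpow_neg_one]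
  · rw [Kpow_add, ← mul_assoc, Kpow_neg_one, E_mul_Kinv, smul_mul_assoc, mul_assoc, ih,
      mul_smul_comm, smul_smul, ← mul_assoc, neg_add, zpow_add₀ hq2, neg_neg, zpow_one]

/-- This is the origin of the constant in the classification: the `K⁻²` term disappears exactly when
`s t = q² / ((1 - q²) (q - q⁻¹))`, and a quantum Weyl relation remains. -/
theorem shiftE_mul_shiftF (hq : q ≠ 0) (s t : k) :
    shiftE q s * shiftF q t = q ^ 2 • (shiftF q t * shiftE q s) + (q ^ 2 * (q - q⁻¹)⁻¹) • 1
      + (s * t * (1 - q ^ 2) - q ^ 2 * (q - q⁻¹)⁻¹) • (Kinv q * Kinv q) := by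
  have h1 : E q * F q = F q * E q + (q - q⁻¹)⁻¹ • (K q - Kinv q) := by rw [← E_mul_F]; abel
  have h2 : E q * Kinv q * F q = q ^ 2 • (F q * E q * Kinv q) + (q ^ 2 * (q - q⁻¹)⁻¹) • 1
      - (q ^ 2 * (q - q⁻¹)⁻¹) • (Kinv q * Kinv q) := by
    rw [mul_assoc, Kinv_mul_F, mul_smul_comm, ← mul_assoc, h1, add_mul, smul_mul_assoc, sub_mul,
      K_mul_Kinv]
    module
  have h3 : Kinv q * (E q * Kinv q) = (q ^ 2)⁻¹ • (E q * Kinv q * Kinv q) := by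
    rw [← mul_assoc, Kinv_mul_E hq, smul_mul_assoc]
  have h4 : Kinv q * F q = q ^ 2 • (F q * Kinv q) := Kinv_mul_F q
  simp only [shiftE, shiftF, add_mul, mul_add, smul_mul_assoc, mul_smul_comm, h2, h3, h4,
    ← mul_assoc (F q) (E q)]
  match_scalars
  all_goals field_simp
  all_goals ring

theorem shiftE_mul_shiftF_of_eq (hq : q ≠ 0) (hq2 : q ^ 2 ≠ 1) {s t : k}
    (hst : s * t = q ^ 2 / ((1 - q ^ 2) * (q - q⁻¹))) :
    shiftE q s * shiftF q t
      = q ^ 2 • (shiftF q t * shiftE q s) + (q ^ 2 * (q - q⁻¹)⁻¹) • 1 := by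
  have h : s * t * (1 - q ^ 2) - q ^ 2 * (q - q⁻¹)⁻¹ = 0 := by
    have : 1 - q ^ 2 ≠ 0 := sub_ne_zero.2 hq2.symm
    rw [hst, mul_comm (1 - q ^ 2), ← div_div, div_mul_cancel₀ _ this, div_eq_mul_inv, sub_self]
  rw [shiftE_mul_shiftF hq, h, zero_smul, add_zero]

/-- The span contains `1` and is stable under left multiplication by the four generators, so it is a
left ideal equal to `U`. -/
theorem span_pbw (hq : q ≠ 0) (s t : k) : Submodule.span k (Set.range (pbw q s t)) = ⊤ := by
  set S := Submodule.span k (Set.range (pbw q s t)) with hS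
  have stable : ∀ a : Uqsl2 q, (∀ p, a * pbw q s t p ∈ S) → ∀ m ∈ S, a * m ∈ S := by
    intro a ha m hm
    induction hm using Submodule.span_induction with
    | mem x hx => obtain ⟨p, rfl⟩ := hx; exact ha p
    | zero => rw [mul_zero]; exact S.zero_mem
    | add x y _ _ hx hy => rw [mul_add]; exact S.add_mem hx hy
    | smul c x _ hx => rw [mul_smul_comm]; exact S.smul_mem c hx
  have hmem : ∀ n i j, Kpow q n * (shiftF q t ^ i * shiftE q s ^ j) ∈ S := fun n i j =>
    Submodule.subset_span ⟨(n, i, j), rfl⟩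
  have hK : ∀ n, ∀ m ∈ S, Kpow q n * m ∈ S := fun n => stable _ fun p => by
    rw [pbw, ← mul_assoc, ← Kpow_add]; exact hmem _ _ _
  have hKi : ∀ m ∈ S, Kinv q * m ∈ S := by simpa only [Kpow_neg_one] using hK (-1)
  have hF : ∀ m ∈ S, F q * m ∈ S := stable _ fun p => by
    have h1 : F q = shiftF q t - t • Kinv q := by rw [shiftF, add_sub_cancel_right]
    rw [pbw, ← mul_assoc, F_mul_Kpow hq, smul_mul_assoc, mul_assoc]
    refine S.smul_mem _ (hK _ _ ?_)
    rw [h1, sub_mul, ← mul_assoc, ← pow_succ', smul_mul_assoc]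
    refine S.sub_mem ?_ (S.smul_mem _ (hKi _ ?_))
    · simpa [Kpow_zero] using hmem 0 (p.2.1 + 1) p.2.2
    · simpa [Kpow_zero] using hmem 0 p.2.1 p.2.2
  have hy : ∀ m ∈ S, shiftF q t * m ∈ S := fun m hm => by
    rw [shiftF, add_mul, smul_mul_assoc]
    exact S.add_mem (hF m hm) (S.smul_mem _ (hKi m hm))
  -- Moving `shiftE` past one `shiftF` costs only terms already known to lie in `S`.
  have hx : ∀ i j, shiftE q s * (shiftF q t ^ i * shiftE q s ^ j) ∈ S := by
    intro i j
    induction i with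
    | zero => simpa [Kpow_zero, pow_succ'] using hmem 0 0 (j + 1)
    | succ i ih =>
      have h0 : shiftF q t ^ i * shiftE q s ^ j ∈ S := by simpa [Kpow_zero] using hmem 0 i j
      rw [pow_succ', mul_assoc, ← mul_assoc, shiftE_mul_shiftF hq, add_mul, add_mul,
        smul_mul_assoc, smul_mul_assoc, smul_mul_assoc, mul_assoc (shiftF q t), mul_assoc (Kinv q), one_mul]
      exact S.add_mem (S.add_mem (S.smul_mem _ (hy _ ih)) (S.smul_mem _ h0))
        (S.smul_mem _ (hKi _ (hKi _ h0)))
  have hE : ∀ m ∈ S, E q * m ∈ S := stable _ fun p => by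
    have h1 : E q = (q ^ 2)⁻¹ • (Kpow q 1 * shiftE q s) - ((q ^ 2)⁻¹ * s) • 1 := by
      rw [Kpow_one, shiftE, mul_add, mul_smul_comm, K_mul_Kinv, ← mul_assoc, K_mul_E,
        smul_mul_assoc, mul_assoc, K_mul_Kinv, mul_one, smul_add, smul_smul, smul_smul,
        inv_mul_cancel₀ (pow_ne_zero 2 hq), one_smul, add_sub_cancel_right]
    rw [pbw, ← mul_assoc, E_mul_Kpow hq, smul_mul_assoc, mul_assoc]
    refine S.smul_mem _ (hK _ _ ?_)
    rw [h1, sub_mul, smul_mul_assoc, smul_mul_assoc, one_mul, mul_assoc]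
    refine S.sub_mem (S.smul_mem _ (hK _ _ (hx _ _))) (S.smul_mem _ ?_)
    simpa [Kpow_zero] using hmem 0 p.2.1 p.2.2
  have hall : ∀ a : Uqsl2 q, ∀ m ∈ S, a * m ∈ S := by
    intro a
    have ha : a ∈ Algebra.adjoin k ({E q, F q, K q, Kinv q} : Set (Uqsl2 q)) := by
      rw [adjoin_generators]; trivial
    induction ha using Algebra.adjoin_induction with
    | mem x hx =>
      rcases hx with rfl | rfl | rfl | rfl
      · exact hE
      · exact hF
      · simpa only [Kpow_one] using hK 1
      · exact hKi
    | algebraMap r => intro m hm; rw [← Algebra.smul_def]; exact S.smul_mem r hm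
    | add x y _ _ hx hy => intro m hm; rw [add_mul]; exact S.add_mem (hx m hm) (hy m hm)
    | mul x y _ _ hx hy => intro m hm; rw [mul_assoc]; exact hx _ (hy m hm)
  rw [eq_top_iff]
  intro a _
  have h1 : (1 : Uqsl2 q) ∈ S := by simpa [Kpow_zero] using hmem 0 0 0
  simpa using hall a 1 h1

end Relations

/-! ### The coaction matrix in PBW bases. -/

section Coaction

variable {k : Type u} [Field k] {q : k}

theorem sub_inv_ne_zero (hq : q ≠ 0) (hq2 : q ^ 2 ≠ 1) : q - q⁻¹ ≠ 0 := by
  intro h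
  rw [sub_eq_zero] at h
  exact hq2 (by rw [pow_two]; nth_rewrite 2 [h]; exact mul_inv_cancel₀ hq)

/-- The two-dimensional irreducible representation. -/
noncomputable def rep2 (hq : q ≠ 0) (hq2 : q ^ 2 ≠ 1) : Uqsl2 q →ₐ[k] Matrix (Fin 2) (Fin 2) k :=
  lift q !![0, 1; 0, 0] !![0, 0; 1, 0] !![q, 0; 0, q⁻¹] !![q⁻¹, 0; 0, q]
    (by simp [Matrix.one_fin_two, hq]) (by simp [Matrix.one_fin_two, hq])
    (by ext i j; fin_cases i <;> fin_cases j <;> simp [pow_two, hq])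
    (by ext i j; fin_cases i <;> fin_cases j <;> simp [pow_two, hq])
    (by
      have h := sub_inv_ne_zero hq hq2
      have h' : (q - q⁻¹)⁻¹ * (q⁻¹ - q) = -1 := by
        rw [← neg_sub q q⁻¹, mul_neg, inv_mul_cancel₀ h]
      ext i j
      fin_cases i <;> fin_cases j <;> simp [inv_mul_cancel₀ h, h'])

/-- The map `U ⊗ U → M₂(k) ⊗ U = M₂(U)` given by the two-dimensional representation. -/
noncomputable def rep2Tensor (hq : q ≠ 0) (hq2 : q ^ 2 ≠ 1) :
    Uqsl2 q ⊗[k] Uqsl2 q →ₐ[k] Matrix (Fin 2) (Fin 2) (Uqsl2 q) :=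
  (matrixEquivTensor (Fin 2) k (Uqsl2 q)).symm.toAlgHom.comp
    ((Algebra.TensorProduct.comm k (Matrix (Fin 2) (Fin 2) k) (Uqsl2 q)).toAlgHom.comp
      (Algebra.TensorProduct.map (rep2 hq hq2) (AlgHom.id k (Uqsl2 q))))

/-- The coaction matrix of the two-dimensional representation: the image of `Δ(a)` in
`M₂(k) ⊗ U = M₂(U)`. -/
noncomputable def coact (hq : q ≠ 0) (hq2 : q ^ 2 ≠ 1) :
    Uqsl2 q →ₐ[k] Matrix (Fin 2) (Fin 2) (Uqsl2 q) :=
  (rep2Tensor hq hq2).comp (comulHom q)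

variable (hq : q ≠ 0) (hq2 : q ^ 2 ≠ 1)

theorem rep2Tensor_tmul_apply (a b : Uqsl2 q) (i j : Fin 2) :
    rep2Tensor hq hq2 (a ⊗ₜ[k] b) i j = rep2 hq hq2 a i j • b := by
  simp [rep2Tensor, Algebra.smul_def, Algebra.commutes]

theorem rep2_E : rep2 hq hq2 (E q) = !![0, 1; 0, 0] := lift_E ..

theorem rep2_F : rep2 hq hq2 (F q) = !![0, 0; 1, 0] := lift_F ..

theorem rep2_K : rep2 hq hq2 (K q) = !![q, 0; 0, q⁻¹] := lift_K ..

theorem rep2_Kinv : rep2 hq hq2 (Kinv q) = !![q⁻¹, 0; 0, q] := lift_Kinv ..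

theorem coact_E : coact hq hq2 (E q) = !![q • E q, 1; 0, q⁻¹ • E q] := by
  ext i j
  fin_cases i <;> fin_cases j <;>
    simp [coact, comulHom_E, rep2Tensor_tmul_apply, rep2_E, rep2_K]

theorem coact_F : coact hq hq2 (F q) = !![F q, 0; Kinv q, F q] := by
  ext i j
  fin_cases i <;> fin_cases j <;>
    simp [coact, comulHom_F, rep2Tensor_tmul_apply, rep2_F]

theorem coact_K : coact hq hq2 (K q) = !![q • K q, 0; 0, q⁻¹ • K q] := by
  ext i j
  fin_cases i <;> fin_cases j <;>
    simp [coact, comulHom_K, rep2Tensor_tmul_apply, rep2_K]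

theorem coact_Kinv : coact hq hq2 (Kinv q) = !![q⁻¹ • Kinv q, 0; 0, q • Kinv q] := by
  ext i j
  fin_cases i <;> fin_cases j <;>
    simp [coact, comulHom_Kinv, rep2Tensor_tmul_apply, rep2_Kinv]

/-- `K⁻¹` has eigenvalues `q⁻¹` and `q` on the two weight vectors, which rescales `s` on the
diagonal. This is why images of one PBW family are expressed in a family with other parameters. -/
theorem coact_shiftE (s : k) :
    coact hq hq2 (shiftE q s) = !![shiftE q (s * q⁻¹), q • Kinv q; 0, shiftE q (s * q)] := by
  rw [shiftE, map_add, map_mul, map_smul, coact_E, coact_Kinv]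
  simp [shiftE, smul_smul, hq]

theorem coact_shiftF (t : k) :
    coact hq hq2 (shiftF q t) = !![shiftF q (t * q⁻¹), 0; Kinv q, shiftF q (t * q)] := by
  rw [shiftF, map_add, map_smul, coact_F, coact_Kinv]
  simp [shiftF, smul_smul]

theorem coact_Kpow (n : ℤ) :
    coact hq hq2 (Kpow q n) = !![q ^ n • Kpow q n, 0; 0, q ^ (-n) • Kpow q n] := by
  induction n using Kpow_induction with
  | zero => simp [Kpow_zero, Matrix.one_fin_two]
  | succ n ih =>
    rw [Kpow_add, map_mul, ih, Kpow_one, coact_K]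
    simp [smul_smul, zpow_add₀ hq, mul_comm]
  | pred n ih =>
    rw [Kpow_add, map_mul, ih, Kpow_neg_one, coact_Kinv]
    simp [smul_smul, zpow_add₀ hq, mul_comm]

theorem coact_mul_apply (a b : Uqsl2 q) (i j : Fin 2) :
    coact hq hq2 (a * b) i j =
      coact hq hq2 a i 0 * coact hq hq2 b 0 j + coact hq hq2 a i 1 * coact hq hq2 b 1 j := by
  rw [map_mul, Matrix.mul_apply, Fin.sum_univ_two]

theorem Kpow_mul_Kinv_mul (n : ℤ) (a : Uqsl2 q) :
    Kpow q n * (Kinv q * a) = Kpow q (n - 1) * a := by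
  rw [← Kpow_neg_one, ← mul_assoc, ← Kpow_add, sub_eq_add_neg]

/-- The entry `(1, 0)` of the coaction matrix of the basis `K ^ n F ^ i (E K⁻¹) ^ j`. -/
theorem coact_pbw_one_zero (p : ℤ × ℕ × ℕ) :
    coact hq hq2 (pbw q 0 0 p) 1 0 =
      (q ^ (-p.1) * geomSum (q ^ 2)⁻¹ p.2.1) • pbw q 0 0 (p.1 - 1, p.2.1 - 1, p.2.2) := by
  obtain ⟨n, i, j⟩ := p
  -- Powers of `E K⁻¹` have upper triangular matrices, so only the powers of `F` feed the entry `(1,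
  -- 0)`.
  have hE : coact hq hq2 (shiftE q 0 ^ j) 0 0 = shiftE q 0 ^ j ∧
      coact hq hq2 (shiftE q 0 ^ j) 1 0 = 0 := by
    induction j with
    | zero => simp
    | succ j ih =>
      rw [pow_succ', coact_mul_apply hq hq2 (shiftE q 0),
        coact_mul_apply hq hq2 (shiftE q 0), ih.1, ih.2, coact_shiftE]
      simp
  have hF : coact hq hq2 (shiftF q 0 ^ i * shiftE q 0 ^ j) 0 0 =
      shiftF q 0 ^ i * shiftE q 0 ^ j ∧ coact hq hq2 (shiftF q 0 ^ i * shiftE q 0 ^ j) 1 0 =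
      geomSum (q ^ 2)⁻¹ i • (Kinv q * (shiftF q 0 ^ (i - 1) * shiftE q 0 ^ j)) := by
    induction i with
    | zero => simpa [geomSum_zero] using hE
    | succ i ih =>
      rw [pow_succ', mul_assoc, coact_mul_apply hq hq2 (shiftF q 0),
        coact_mul_apply hq hq2 (shiftF q 0), ih.1, ih.2, coact_shiftF]
      refine ⟨by simp, ?_⟩
      -- Each factor `F` contributes one `K⁻¹`; moving it to the left through the preceding factors
      -- `F` yields powers of `q⁻²`, which add up to the geometric sum.
      rcases i with _ | i
      · simp [geomSum_succ, geomSum_zero]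
      · have h1 : shiftF q 0 * Kinv q = (q ^ 2)⁻¹ • (Kinv q * shiftF q 0) := by
          simp [shiftF, F_mul_Kinv hq]
        simp only [Matrix.of_apply, Matrix.cons_val, zero_mul, Nat.add_sub_cancel, mul_smul_comm]
        rw [← mul_assoc (shiftF q 0) (Kinv q), h1, smul_mul_assoc, smul_smul, mul_assoc (Kinv q),
          ← mul_assoc (shiftF q 0), ← pow_succ', geomSum_succ _ (i + 1), add_smul, one_smul,
          add_comm, mul_comm]
  rw [pbw, coact_mul_apply, hF.2, coact_Kpow]
  simp [pbw, Kpow_mul_Kinv_mul, smul_smul, mul_comm]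

/-- The entry `(0, 1)` of the coaction matrix of the basis `K ^ n F ^ i (E K⁻¹) ^ j`. -/
theorem coact_pbw_zero_one (p : ℤ × ℕ × ℕ) :
    coact hq hq2 (pbw q 0 0 p) 0 1 =
      (q ^ p.1 * ((q ^ 2)⁻¹ ^ p.2.1 * (q * geomSum (q ^ 2) p.2.2))) •
        pbw q 0 0 (p.1 - 1, p.2.1, p.2.2 - 1) := by
  obtain ⟨n, i, j⟩ := p
  have hE : coact hq hq2 (shiftE q 0 ^ j) 1 1 = shiftE q 0 ^ j ∧
      coact hq hq2 (shiftE q 0 ^ j) 0 1 =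
        (q * geomSum (q ^ 2) j) • (Kinv q * shiftE q 0 ^ (j - 1)) := by
    induction j with
    | zero => simp [geomSum_zero]
    | succ j ih =>
      rw [pow_succ', coact_mul_apply hq hq2 (shiftE q 0),
        coact_mul_apply hq hq2 (shiftE q 0), ih.1, ih.2, coact_shiftE]
      refine ⟨by simp, ?_⟩
      rcases j with _ | j
      · simp [geomSum_succ, geomSum_zero]
      · have h1 : shiftE q 0 * Kinv q = q ^ 2 • (Kinv q * shiftE q 0) := by
          rw [shiftE, zero_smul, add_zero, E_mul_Kinv, smul_mul_assoc, mul_assoc, E_mul_Kinv]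
        simp only [Matrix.of_apply, Matrix.cons_val, zero_mul, Nat.add_sub_cancel, mul_smul_comm]
        rw [← mul_assoc (shiftE q _) (Kinv q), h1, smul_mul_assoc, smul_smul, mul_assoc (Kinv q),
          ← pow_succ', geomSum_succ _ (j + 1), smul_mul_assoc, ← add_smul]
        congr 1
        ring
  have hF : coact hq hq2 (shiftF q 0 ^ i * shiftE q 0 ^ j) 0 1 =
      ((q ^ 2)⁻¹ ^ i * (q * geomSum (q ^ 2) j)) •
        (Kinv q * (shiftF q 0 ^ i * shiftE q 0 ^ (j - 1))) := by
    induction i with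
    | zero => simpa using hE.2
    | succ i ih =>
      have h1 : shiftF q 0 * Kinv q = (q ^ 2)⁻¹ • (Kinv q * shiftF q 0) := by
        simp [shiftF, F_mul_Kinv hq]
      rw [pow_succ', mul_assoc, coact_mul_apply hq hq2 (shiftF q 0), ih, coact_shiftF]
      simp only [Matrix.of_apply, Matrix.cons_val, zero_mul, mul_smul_comm, add_zero]
      rw [← mul_assoc (shiftF q _) (Kinv q), h1, smul_mul_assoc, smul_smul, mul_assoc (Kinv q),
        ← mul_assoc (shiftF q 0)]
      congr 1
      ring
  rw [pbw, coact_mul_apply, hF, coact_Kpow]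
  simp [pbw, Kpow_mul_Kinv_mul, smul_smul, mul_comm]

/-- For `s t = q² / ((1 - q²) (q - q⁻¹))` and `b = s (1 - q⁻²)`, the coaction of
`K ^ n (F + t K⁻¹) ^ i (E K⁻¹ + s K⁻¹) ^ j` on the vector `(1, b)`. -/
theorem coact_pbw_of_eq {s t b : k} (hb : b = s * (1 - (q ^ 2)⁻¹))
    (hbt : 1 + b * t * q = b * t * q⁻¹) (p : ℤ × ℕ × ℕ) :
    b • (coact hq hq2 (pbw q s t p) 0 0 + b • coact hq hq2 (pbw q s t p) 0 1) -
      (coact hq hq2 (pbw q s t p) 1 0 + b • coact hq hq2 (pbw q s t p) 1 1) =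
      (b * (q ^ p.1 - q ^ (-p.1))) • pbw q (s * q) (t * q⁻¹) p := by
  -- The pair of equations says that the matrix of `m` sends the column `(1, b)` to `(1, b)` times
  -- `z`. This property is multiplicative, so it suffices to check the two generators.
  have hmul : ∀ {m z m' z' : Uqsl2 q},
      (coact hq hq2 m 0 0 + b • coact hq hq2 m 0 1 = z ∧
        coact hq hq2 m 1 0 + b • coact hq hq2 m 1 1 = b • z) →
      (coact hq hq2 m' 0 0 + b • coact hq hq2 m' 0 1 = z' ∧
        coact hq hq2 m' 1 0 + b • coact hq hq2 m' 1 1 = b • z') →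
      (coact hq hq2 (m * m') 0 0 + b • coact hq hq2 (m * m') 0 1 = z * z' ∧
        coact hq hq2 (m * m') 1 0 + b • coact hq hq2 (m * m') 1 1 = b • (z * z')) := by
    rintro m z m' z' ⟨h1, h2⟩ ⟨h3, h4⟩
    have key : ∀ i, coact hq hq2 (m * m') i 0 + b • coact hq hq2 (m * m') i 1 =
        (coact hq hq2 m i 0 + b • coact hq hq2 m i 1) * z' := by
      intro i
      rw [coact_mul_apply, coact_mul_apply, add_mul, smul_mul_assoc, ← mul_smul_comm, ← h4, ← h3]
      simp only [mul_add, smul_add, mul_smul_comm]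
      abel
    exact ⟨by rw [key, h1], by rw [key, h2, smul_mul_assoc]⟩
  have hpow : ∀ {m z : Uqsl2 q},
      (coact hq hq2 m 0 0 + b • coact hq hq2 m 0 1 = z ∧
        coact hq hq2 m 1 0 + b • coact hq hq2 m 1 1 = b • z) → ∀ n : ℕ,
      (coact hq hq2 (m ^ n) 0 0 + b • coact hq hq2 (m ^ n) 0 1 = z ^ n ∧
        coact hq hq2 (m ^ n) 1 0 + b • coact hq hq2 (m ^ n) 1 1 = b • z ^ n) := by
    intro m z h n
    induction n with
    | zero => simp
    | succ n ih => rw [pow_succ', pow_succ']; exact hmul h ih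
  -- `hb` is precisely the condition `s q⁻¹ + b q = s q` under which `(1, b)` is an eigencolumn of
  -- `shiftE q s`; `hbt` plays this role for `shiftF q t`.
  have hE : coact hq hq2 (shiftE q s) 0 0 + b • coact hq hq2 (shiftE q s) 0 1 = shiftE q (s * q) ∧
      coact hq hq2 (shiftE q s) 1 0 + b • coact hq hq2 (shiftE q s) 1 1
        = b • shiftE q (s * q) := by
    rw [coact_shiftE]
    refine ⟨?_, by simp⟩
    simp only [Matrix.of_apply, Matrix.cons_val, shiftE, hb]
    match_scalars <;> field_simp
    ring
  have hF : coact hq hq2 (shiftF q t) 0 0 + b • coact hq hq2 (shiftF q t) 0 1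
        = shiftF q (t * q⁻¹) ∧
      coact hq hq2 (shiftF q t) 1 0 + b • coact hq hq2 (shiftF q t) 1 1
        = b • shiftF q (t * q⁻¹) := by
    rw [coact_shiftF]
    refine ⟨by simp, ?_⟩
    simp only [Matrix.of_apply, Matrix.cons_val, shiftF]
    match_scalars
    · linear_combination hbt
    · ring
  obtain ⟨n, i, j⟩ := p
  obtain ⟨h1, h2⟩ := hmul (hpow hF i) (hpow hE j)
  -- Only `K ^ n` moves the line: it scales the rows by `q ^ n` and `q ^ (-n)`, whence the factor `q
  -- ^ n - q ^ (-n)`.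
  have key : ∀ l, coact hq hq2 (pbw q s t (n, i, j)) 0 l =
      q ^ n • (Kpow q n * coact hq hq2 (shiftF q t ^ i * shiftE q s ^ j) 0 l) ∧
      coact hq hq2 (pbw q s t (n, i, j)) 1 l =
      q ^ (-n) • (Kpow q n * coact hq hq2 (shiftF q t ^ i * shiftE q s ^ j) 1 l) := by
    intro l
    rw [pbw, coact_mul_apply hq hq2 (Kpow q n), coact_mul_apply hq hq2 (Kpow q n), coact_Kpow]
    simp [-map_mul]
  rw [(key 0).1, (key 1).1, (key 0).2, (key 1).2, smul_comm b (q ^ n), ← smul_add,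
    smul_comm b (q ^ (-n)), ← smul_add, ← mul_smul_comm, ← mul_smul_comm, ← mul_add, ← mul_add,
    h1, h2, pbw]
  simp only [mul_smul_comm]
  module

end Coaction

/-! ### From stable lines to containment. -/

section Classification

variable {k : Type u} [Field k] {q : k} (hq : q ≠ 0) (hq2 : q ^ 2 ≠ 1)

/-- The subalgebra `C` maps the vector `w` of the two-dimensional representation into the line
spanned by `w`. -/
def Stabilizes (C : Subalgebra k (Uqsl2 q)) (w : Fin 2 → k) : Prop :=
  ∀ c ∈ C, ∃ μ : k, (rep2 hq hq2 c).mulVec w = μ • w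

/-- The entry `(i, j)` of the coaction matrix as a linear map. -/
noncomputable def coactEntry (i j : Fin 2) : Uqsl2 q →ₗ[k] Uqsl2 q :=
  Matrix.entryLinearMap k (Uqsl2 q) i j ∘ₗ (coact hq hq2).toLinearMap

theorem coactEntry_apply (i j : Fin 2) (a : Uqsl2 q) :
    coactEntry hq hq2 i j a = coact hq hq2 a i j := rfl

/-- On a pure tensor `x ⊗ y` with `x ∈ C` the element `x` scales `w` by some `μ`, and `a = μ • y`
works; sums of tensors add up. -/
theorem Stabilizes.exists_coact_eq {C : Subalgebra k (Uqsl2 q)} {w : Fin 2 → k}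
    (h : Stabilizes hq hq2 C w) (hC : IsRightCoidealSubalgebra C) {c : Uqsl2 q} (hc : c ∈ C) :
    ∃ a : Uqsl2 q, ∀ i, w 0 • coact hq hq2 c i 0 + w 1 • coact hq hq2 c i 1 = w i • a := by
  obtain ⟨x, hx⟩ := hC c hc
  have hx' : LinearMap.rTensor (Uqsl2 q) (Subalgebra.toSubmodule C).subtype x = comulHom q c := hx
  clear hx
  rw [coact, AlgHom.comp_apply, ← hx']
  clear hx'
  induction x using TensorProduct.induction_on with
  | zero => exact ⟨0, fun i => by simp⟩
  | add x y hx hy =>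
    obtain ⟨a, ha⟩ := hx
    obtain ⟨b, hb⟩ := hy
    refine ⟨a + b, fun i => ?_⟩
    rw [smul_add, ← ha, ← hb, map_add, map_add, Matrix.add_apply, Matrix.add_apply]
    module
  | tmul x y =>
    obtain ⟨μ, hμ⟩ := h x x.2
    refine ⟨μ • y, fun i => ?_⟩
    have h1 := congrFun hμ i
    rw [Matrix.mulVec, dotProduct, Fin.sum_univ_two, Pi.smul_apply, smul_eq_mul] at h1
    simp only [LinearMap.rTensor_tmul, Submodule.coe_subtype, rep2Tensor_tmul_apply, smul_smul]
    rw [← add_smul, mul_comm (w i), ← h1]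
    congr 1
    ring

/-- The integral powers of `K` lie in every subalgebra that contains `K` and `K⁻¹`. -/
theorem Kpow_mem {C : Subalgebra k (Uqsl2 q)} (hK : K q ∈ C) (hKi : Kinv q ∈ C) (n : ℤ) :
    Kpow q n ∈ C := by
  induction n using Kpow_induction with
  | zero => rw [Kpow_zero]; exact C.one_mem
  | succ n ih => rw [Kpow_add, Kpow_one]; exact C.mul_mem hK ih
  | pred n ih => rw [Kpow_add, Kpow_neg_one]; exact C.mul_mem hKi ih

variable {C : Subalgebra k (Uqsl2 q)}

/-- Stability of `(1, 0)` kills the entry `(1, 0)` of the coaction matrix. Its coefficient on a PBW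
monomial vanishes only when no factor `F` occurs. -/
theorem Stabilizes.le_nonnegPart (hr : ∀ n : ℕ, 0 < n → (q ^ 2)⁻¹ ^ n ≠ 1)
    (h : Stabilizes hq hq2 C ![1, 0]) (hC : IsRightCoidealSubalgebra C) : C ≤ nonnegPart q := by
  intro c hc
  obtain ⟨a, ha⟩ := h.exists_coact_eq hq hq2 hC hc
  have h1 : c ∈ LinearMap.ker (coactEntry hq hq2 1 0) := by
    have := ha 1
    simp only [Matrix.cons_val, one_smul, zero_smul, add_zero] at this
    exact this
  have h2 := LinearMap.ker_le_span_of_apply_eq_smul (span_pbw hq 0 0)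
    (linearIndependent_pbw hq 0 0) _ _ (fun p => (p.1 - 1, p.2.1 - 1, p.2.2)) (by
      rintro ⟨n, i, j⟩ hp ⟨n', i', j'⟩ hp' heq
      -- The index map uses `i - 1`, which is injective only away from `i = 0`, where the
      -- coefficient vanishes.
      have hi : i ≠ 0 := by rintro rfl; simp [geomSum_zero] at hp
      have hi' : i' ≠ 0 := by rintro rfl; simp [geomSum_zero] at hp'
      simp only [Prod.mk.injEq] at heq ⊢
      omega) (coact_pbw_one_zero hq hq2) h1
  refine (Submodule.span_le (p := Subalgebra.toSubmodule (nonnegPart q))).2 ?_ h2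
  rintro _ ⟨⟨n, i, j⟩, hp, rfl⟩
  have hi : i = 0 := by
    by_contra hi
    exact mul_ne_zero (zpow_ne_zero _ hq) (geomSum_ne_zero hr hi) hp
  subst hi
  have hE : E q ∈ nonnegPart q := Algebra.subset_adjoin (by simp)
  have hK : K q ∈ nonnegPart q := Algebra.subset_adjoin (by simp)
  have hKi : Kinv q ∈ nonnegPart q := Algebra.subset_adjoin (by simp)
  have hX : shiftE q 0 ∈ nonnegPart q := by
    rw [shiftE, zero_smul, add_zero]; exact Subalgebra.mul_mem _ hE hKi
  exact Subalgebra.mul_mem _ (Kpow_mem hK hKi n)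
    (Subalgebra.mul_mem _ (by simp) (Subalgebra.pow_mem _ hX j))

theorem Stabilizes.le_nonposPart (hr : ∀ n : ℕ, 0 < n → (q ^ 2) ^ n ≠ 1)
    (h : Stabilizes hq hq2 C ![0, 1]) (hC : IsRightCoidealSubalgebra C) : C ≤ nonposPart q := by
  intro c hc
  obtain ⟨a, ha⟩ := h.exists_coact_eq hq hq2 hC hc
  have h1 : c ∈ LinearMap.ker (coactEntry hq hq2 0 1) := by
    have := ha 0
    simp only [Matrix.cons_val, one_smul, zero_smul, zero_add] at this
    exact this
  have h2 := LinearMap.ker_le_span_of_apply_eq_smul (span_pbw hq 0 0)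
    (linearIndependent_pbw hq 0 0) _ _ (fun p => (p.1 - 1, p.2.1, p.2.2 - 1)) (by
      rintro ⟨n, i, j⟩ hp ⟨n', i', j'⟩ hp' heq
      have hj : j ≠ 0 := by rintro rfl; simp [geomSum_zero] at hp
      have hj' : j' ≠ 0 := by rintro rfl; simp [geomSum_zero] at hp'
      simp only [Prod.mk.injEq] at heq ⊢
      omega) (coact_pbw_zero_one hq hq2) h1
  refine (Submodule.span_le (p := Subalgebra.toSubmodule (nonposPart q))).2 ?_ h2
  rintro _ ⟨⟨n, i, j⟩, hp, rfl⟩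
  have hj : j = 0 := by
    by_contra hj
    exact mul_ne_zero (zpow_ne_zero _ hq) (mul_ne_zero
      (pow_ne_zero _ (inv_ne_zero (pow_ne_zero 2 hq))) (mul_ne_zero hq (geomSum_ne_zero hr hj))) hp
  subst hj
  have hF : F q ∈ nonposPart q := Algebra.subset_adjoin (by simp)
  have hK : K q ∈ nonposPart q := Algebra.subset_adjoin (by simp)
  have hKi : Kinv q ∈ nonposPart q := Algebra.subset_adjoin (by simp)
  have hX : shiftF q 0 ∈ nonposPart q := by rw [shiftF, zero_smul, add_zero]; exact hF
  exact Subalgebra.mul_mem _ (Kpow_mem hK hKi n)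
    (Subalgebra.mul_mem _ (Subalgebra.pow_mem _ hX i) (by simp))

/-- The map that vanishes on `C` is `b` times the first row minus the second row, applied to `(1,
b)`. It is diagonal with coefficient `b (q ^ n - q ^ (-n))`, so only monomials without a power of
`K` survive in the kernel. -/
theorem Stabilizes.le_shiftedPart (hr : ∀ n : ℤ, n ≠ 0 → q ^ n ≠ q ^ (-n)) {s t b : k}
    (hb : b = s * (1 - (q ^ 2)⁻¹)) (hbt : 1 + b * t * q = b * t * q⁻¹)
    (h : Stabilizes hq hq2 C ![1, b]) (hC : IsRightCoidealSubalgebra C) :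
    C ≤ shiftedPart q s t := by
  have hb0 : b ≠ 0 := by rintro rfl; simp at hbt
  intro c hc
  obtain ⟨a, ha⟩ := h.exists_coact_eq hq hq2 hC hc
  have h1 : c ∈ LinearMap.ker (b • (coactEntry hq hq2 0 0 + b • coactEntry hq hq2 0 1) -
      (coactEntry hq hq2 1 0 + b • coactEntry hq hq2 1 1)) := by
    have h0 := ha 0
    have h1 := ha 1
    simp only [Matrix.cons_val, one_smul] at h0 h1
    rw [LinearMap.mem_ker]
    simp only [LinearMap.sub_apply, LinearMap.smul_apply, LinearMap.add_apply, coactEntry_apply,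
      h0, h1, sub_self]
  have h2 := LinearMap.ker_le_span_of_apply_eq_smul (span_pbw hq s t)
    (linearIndependent_pbw hq (s * q) (t * q⁻¹)) _ _ id Function.injective_id.injOn
    (coact_pbw_of_eq hq hq2 hb hbt) h1
  refine (Submodule.span_le (p := Subalgebra.toSubmodule (shiftedPart q s t))).2 ?_ h2
  rintro _ ⟨⟨n, i, j⟩, hp, rfl⟩
  have hn : n = 0 := by
    by_contra hn
    exact mul_ne_zero hb0 (sub_ne_zero.2 (hr n hn)) hp
  subst hn
  have hx : shiftE q s ∈ shiftedPart q s t := Algebra.subset_adjoin (Or.inl rfl)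
  have hy : shiftF q t ∈ shiftedPart q s t := Algebra.subset_adjoin (Or.inr rfl)
  rw [pbw, Kpow_zero, one_mul]
  exact Subalgebra.mul_mem _ (Subalgebra.pow_mem _ hy i) (Subalgebra.pow_mem _ hx j)

/-- Without a stable line, every nonzero submodule would contain independent vectors `w` and `c •
w`, and the plane would be a simple module of dimension two. -/
theorem exists_stabilizes (hC : IsBasicAlgebra k C) :
    ∃ w : Fin 2 → k, w ≠ 0 ∧ Stabilizes hq hq2 C w := by
  let f : C →ₐ[k] Module.End k (Fin 2 → k) :=
    ((Matrix.toLinAlgEquiv' (R := k) (n := Fin 2)).toAlgHom.comp (rep2 hq hq2)).comp C.val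
  let _ : Module C (Fin 2 → k) := Module.compHom (Fin 2 → k) f.toRingHom
  have hsmul : ∀ (c : C) (w : Fin 2 → k), c • w = (rep2 hq hq2 c).mulVec w := fun c w => rfl
  have : IsScalarTower k C (Fin 2 → k) := ⟨fun r c w => by
    rw [hsmul, hsmul, Subalgebra.coe_smul, map_smul, Matrix.smul_mulVec]⟩
  have hns : ¬ IsSimpleModule C (Fin 2 → k) := by
    intro h
    have := hC (Fin 2 → k)
    simp at this
  by_contra hno
  push Not at hno
  refine hns ?_
  rw [isSimpleModule_iff]
  refine { exists_pair_ne := ⟨⊥, ⊤, bot_ne_top⟩, eq_bot_or_eq_top := fun N => ?_ }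
  rw [or_iff_not_imp_left]
  intro hN
  obtain ⟨w, hwN, hw0⟩ := N.exists_mem_ne_zero_of_ne_bot hN
  have h1 := hno w hw0
  simp only [Stabilizes] at h1
  push Not at h1
  obtain ⟨c, hc, hcw⟩ := h1
  have hli : LinearIndependent k ![w, (⟨c, hc⟩ : C) • w] := by
    rw [LinearIndependent.pair_iff' hw0]
    exact fun μ h => hcw μ h.symm
  have hsp := hli.span_eq_top_of_card_eq_finrank (by simp)
  rw [eq_top_iff]
  intro u _
  have hle : Submodule.span k (Set.range ![w, (⟨c, hc⟩ : C) • w]) ≤ N.restrictScalars k := by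
    rw [Submodule.span_le]
    rintro _ ⟨i, rfl⟩
    fin_cases i
    · exact hwN
    · exact N.smul_mem _ hwN
  exact hle (hsp ▸ Submodule.mem_top)

theorem Stabilizes.of_smul {w w' : Fin 2 → k} {r : k} (hr : r ≠ 0) (h : w = r • w')
    (hw : Stabilizes hq hq2 C w) : Stabilizes hq hq2 C w' := by
  intro c hc
  obtain ⟨μ, hμ⟩ := hw c hc
  refine ⟨μ, ?_⟩
  rw [h, Matrix.mulVec_smul, smul_comm] at hμ
  exact smul_right_injective _ hr hμ

theorem exists_stabilizes_normalized (hC : IsBasicAlgebra k C) :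
    Stabilizes hq hq2 C ![1, 0] ∨ Stabilizes hq hq2 C ![0, 1] ∨
      ∃ b ≠ 0, Stabilizes hq hq2 C ![1, b] := by
  obtain ⟨w, hw0, hw⟩ := exists_stabilizes hq hq2 hC
  by_cases h1 : w 1 = 0
  · left
    refine hw.of_smul hq hq2 (r := w 0) ?_ ?_
    · intro h0
      exact hw0 (by ext i; fin_cases i <;> simp [h0, h1])
    · ext i; fin_cases i <;> simp [h1]
  by_cases h0 : w 0 = 0
  · right; left
    refine hw.of_smul hq hq2 h1 ?_
    ext i; fin_cases i <;> simp [h0]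
  · right; right
    refine ⟨w 1 / w 0, div_ne_zero h1 h0, hw.of_smul hq hq2 h0 ?_⟩
    ext i; fin_cases i <;> simp [mul_div_cancel₀ _ h0]

/-! ### The listed algebras are basic right coideal subalgebras. -/

/-- Right coideal subalgebras can be recognized on generators. -/
theorem isRightCoidealSubalgebra_adjoin {S : Set (Uqsl2 q)}
    (hS : ∀ a ∈ S, comulHom q a ∈ (Algebra.TensorProduct.map (Algebra.adjoin k S).val
      (AlgHom.id k (Uqsl2 q))).range) : IsRightCoidealSubalgebra (Algebra.adjoin k S) := by
  have h : Algebra.adjoin k S ≤ ((Algebra.TensorProduct.map (Algebra.adjoin k S).val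
      (AlgHom.id k (Uqsl2 q))).range).comap (comulHom q) := Algebra.adjoin_le hS
  intro c hc
  obtain ⟨x, hx⟩ := h hc
  exact ⟨x, hx⟩

theorem tmul_mem_range {D : Subalgebra k (Uqsl2 q)} {a : Uqsl2 q} (ha : a ∈ D) (b : Uqsl2 q) :
    a ⊗ₜ[k] b ∈ (Algebra.TensorProduct.map D.val (AlgHom.id k (Uqsl2 q))).range :=
  ⟨⟨a, ha⟩ ⊗ₜ[k] b, by simp⟩

theorem isRightCoidealSubalgebra_nonnegPart : IsRightCoidealSubalgebra (nonnegPart q) := by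
  refine isRightCoidealSubalgebra_adjoin ?_
  have hE : E q ∈ nonnegPart q := Algebra.subset_adjoin (by simp)
  have hK : K q ∈ nonnegPart q := Algebra.subset_adjoin (by simp)
  have hKi : Kinv q ∈ nonnegPart q := Algebra.subset_adjoin (by simp)
  rintro a (rfl | rfl | rfl)
  · rw [comulHom_E]
    exact Subalgebra.add_mem _ (tmul_mem_range hE _) (tmul_mem_range hK _)
  · rw [comulHom_K]; exact tmul_mem_range hK _
  · rw [comulHom_Kinv]; exact tmul_mem_range hKi _

theorem isRightCoidealSubalgebra_nonposPart : IsRightCoidealSubalgebra (nonposPart q) := by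
  refine isRightCoidealSubalgebra_adjoin ?_
  have hF : F q ∈ nonposPart q := Algebra.subset_adjoin (by simp)
  have hK : K q ∈ nonposPart q := Algebra.subset_adjoin (by simp)
  have hKi : Kinv q ∈ nonposPart q := Algebra.subset_adjoin (by simp)
  rintro a (rfl | rfl | rfl)
  · rw [comulHom_F]
    exact Subalgebra.add_mem _ (tmul_mem_range hF _) (tmul_mem_range (Subalgebra.one_mem _) _)
  · rw [comulHom_K]; exact tmul_mem_range hK _
  · rw [comulHom_Kinv]; exact tmul_mem_range hKi _

/-- The factor `K⁻¹` in `E K⁻¹` turns the term `K ⊗ E` of `Δ(E)` into `1 ⊗ E K⁻¹`. The shift by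
`K⁻¹` merges with the other term, so no condition on `s`, `t` is needed. -/
theorem isRightCoidealSubalgebra_shiftedPart (s t : k) :
    IsRightCoidealSubalgebra (shiftedPart q s t) := by
  refine isRightCoidealSubalgebra_adjoin ?_
  have hx : E q * Kinv q + s • Kinv q ∈ shiftedPart q s t := Algebra.subset_adjoin (Or.inl rfl)
  have hy : F q + t • Kinv q ∈ shiftedPart q s t := Algebra.subset_adjoin (Or.inr rfl)
  have h1 : (1 : Uqsl2 q) ∈ shiftedPart q s t := Subalgebra.one_mem _
  rintro a (rfl | rfl)
  · have h : comulHom q (E q * Kinv q + s • Kinv q) =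
        (E q * Kinv q + s • Kinv q) ⊗ₜ[k] Kinv q + 1 ⊗ₜ[k] (E q * Kinv q) := by
      rw [map_add, map_mul, map_smul, comulHom_E, comulHom_Kinv, add_mul,
        Algebra.TensorProduct.tmul_mul_tmul, Algebra.TensorProduct.tmul_mul_tmul, K_mul_Kinv,
        one_mul, TensorProduct.add_tmul, TensorProduct.smul_tmul']
      abel
    rw [h]
    exact Subalgebra.add_mem _ (tmul_mem_range hx _) (tmul_mem_range h1 _)
  · have h : comulHom q (F q + t • Kinv q) =
        (F q + t • Kinv q) ⊗ₜ[k] Kinv q + 1 ⊗ₜ[k] F q := by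
      rw [map_add, map_smul, comulHom_F, comulHom_Kinv, TensorProduct.add_tmul,
        TensorProduct.smul_tmul']
      abel
    rw [h]
    exact Subalgebra.add_mem _ (tmul_mem_range hy _) (tmul_mem_range h1 _)

/-- An algebra generated by `S` is basic if the elements of `S` have a common eigenvector in every
nonzero finite-dimensional representation. -/
theorem isBasicAlgebra_adjoin {S : Set (Uqsl2 q)}
    (hS : ∀ (V : Type u) [AddCommGroup V] [Module k V] [FiniteDimensional k V] [Nontrivial V]
      (f : Algebra.adjoin k S →ₐ[k] Module.End k V),
      ∃ w : V, w ≠ 0 ∧ ∀ a (ha : a ∈ S), ∃ μ : k, f ⟨a, Algebra.subset_adjoin ha⟩ w = μ • w) :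
    IsBasicAlgebra k (Algebra.adjoin k S) := by
  intro V _ _ _ _ _ _
  have : Nontrivial V := IsSimpleModule.nontrivial (Algebra.adjoin k S) V
  obtain ⟨w, hw0, hw⟩ := hS V (Algebra.lsmul k k V)
  have hall : ∀ a (ha : a ∈ Algebra.adjoin k S), ∃ μ : k,
      (⟨a, ha⟩ : Algebra.adjoin k S) • w = μ • w := by
    intro a ha
    induction ha using Algebra.adjoin_induction with
    | mem x hx => exact hw x hx
    | algebraMap r => exact ⟨r, algebraMap_smul (Algebra.adjoin k S) r w⟩
    | add x y hx hy h1 h2 =>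
      obtain ⟨μ, hμ⟩ := h1
      obtain ⟨ν, hν⟩ := h2
      refine ⟨μ + ν, ?_⟩
      rw [add_smul, ← hμ, ← hν, ← add_smul]
      rfl
    | mul x y hx hy h1 h2 =>
      obtain ⟨μ, hμ⟩ := h1
      obtain ⟨ν, hν⟩ := h2
      refine ⟨ν * μ, ?_⟩
      rw [mul_smul, ← hμ, smul_comm ν, ← hν, ← mul_smul]
      rfl
  let N : Submodule (Algebra.adjoin k S) V :=
    { carrier := {u | ∃ r : k, r • w = u}
      add_mem' := by
        rintro _ _ ⟨r, rfl⟩ ⟨r', rfl⟩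
        exact ⟨r + r', add_smul _ _ _⟩
      zero_mem' := ⟨0, zero_smul _ _⟩
      smul_mem' := by
        rintro ⟨c, hc⟩ _ ⟨r, rfl⟩
        obtain ⟨μ, hμ⟩ := hall c hc
        exact ⟨r * μ, by rw [mul_smul, ← hμ, smul_comm]⟩ }
  have hN : N = ⊤ := (eq_bot_or_eq_top N).resolve_left fun h => hw0 (by
    have : w ∈ N := ⟨1, one_smul _ _⟩
    rwa [h, Submodule.mem_bot] at this)
  refine finrank_eq_one w hw0 fun u => ?_
  have hu : u ∈ N := hN ▸ Submodule.mem_top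
  exact hu

theorem isBasicAlgebra_nonnegPart [IsAlgClosed k] (hq : q ≠ 0)
    (hr : ∀ n : ℕ, 0 < n → (q ^ 2) ^ n ≠ 1) : IsBasicAlgebra k (nonnegPart q) := by
  refine isBasicAlgebra_adjoin fun V _ _ _ _ f => ?_
  have hE : E q ∈ Algebra.adjoin k {E q, K q, Kinv q} := Algebra.subset_adjoin (by simp)
  have hK : K q ∈ Algebra.adjoin k {E q, K q, Kinv q} := Algebra.subset_adjoin (by simp)
  have hKi : Kinv q ∈ Algebra.adjoin k {E q, K q, Kinv q} := Algebra.subset_adjoin (by simp)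
  have h1 : f ⟨K q, hK⟩ * f ⟨Kinv q, hKi⟩ = 1 := by
    rw [← map_mul, ← map_one f]; exact congrArg f (Subtype.ext (K_mul_Kinv q))
  have h2 : f ⟨Kinv q, hKi⟩ * f ⟨K q, hK⟩ = 1 := by
    rw [← map_mul, ← map_one f]; exact congrArg f (Subtype.ext (Kinv_mul_K q))
  have h3 : f ⟨K q, hK⟩ * f ⟨E q, hE⟩ = q ^ 2 • (f ⟨E q, hE⟩ * f ⟨K q, hK⟩) := by
    rw [← map_mul, ← map_mul, ← map_smul]; exact congrArg f (Subtype.ext (K_mul_E q))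
  obtain ⟨w, hw0, hEw, μ, hμ⟩ := Module.End.exists_common_eigenvector_of_mul_eq_smul_mul
    (pow_ne_zero 2 hq) hr ⟨⟨_, _, h1, h2⟩, rfl⟩ h3
  have h4 : μ • f ⟨Kinv q, hKi⟩ w = w := by
    have := LinearMap.congr_fun h2 w
    rwa [Module.End.mul_apply, hμ, map_smul] at this
  have hμ0 : μ ≠ 0 := by rintro rfl; exact hw0 (by rw [← h4, zero_smul])
  refine ⟨w, hw0, ?_⟩
  rintro a (rfl | rfl | rfl)
  · exact ⟨0, by rw [hEw, zero_smul]⟩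
  · exact ⟨μ, hμ⟩
  · exact ⟨μ⁻¹, by nth_rewrite 2 [← h4]; rw [smul_smul, inv_mul_cancel₀ hμ0, one_smul]⟩

theorem isBasicAlgebra_nonposPart [IsAlgClosed k] (hq : q ≠ 0)
    (hr : ∀ n : ℕ, 0 < n → (q ^ 2) ^ n ≠ 1) : IsBasicAlgebra k (nonposPart q) := by
  refine isBasicAlgebra_adjoin fun V _ _ _ _ f => ?_
  have hF : F q ∈ Algebra.adjoin k {F q, K q, Kinv q} := Algebra.subset_adjoin (by simp)
  have hK : K q ∈ Algebra.adjoin k {F q, K q, Kinv q} := Algebra.subset_adjoin (by simp)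
  have hKi : Kinv q ∈ Algebra.adjoin k {F q, K q, Kinv q} := Algebra.subset_adjoin (by simp)
  have h1 : f ⟨K q, hK⟩ * f ⟨Kinv q, hKi⟩ = 1 := by
    rw [← map_mul, ← map_one f]; exact congrArg f (Subtype.ext (K_mul_Kinv q))
  have h2 : f ⟨Kinv q, hKi⟩ * f ⟨K q, hK⟩ = 1 := by
    rw [← map_mul, ← map_one f]; exact congrArg f (Subtype.ext (Kinv_mul_K q))
  -- With `K⁻¹` as the invertible operator, the relation has the same shape and the same scalar `q²`
  -- as for `K` and `E`.
  have h3 : f ⟨Kinv q, hKi⟩ * f ⟨F q, hF⟩ = q ^ 2 • (f ⟨F q, hF⟩ * f ⟨Kinv q, hKi⟩) := by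
    rw [← map_mul, ← map_mul, ← map_smul]; exact congrArg f (Subtype.ext (Kinv_mul_F q))
  obtain ⟨w, hw0, hFw, μ, hμ⟩ := Module.End.exists_common_eigenvector_of_mul_eq_smul_mul
    (pow_ne_zero 2 hq) hr ⟨⟨_, _, h2, h1⟩, rfl⟩ h3
  have h4 : μ • f ⟨K q, hK⟩ w = w := by
    have := LinearMap.congr_fun h1 w
    rwa [Module.End.mul_apply, hμ, map_smul] at this
  have hμ0 : μ ≠ 0 := by rintro rfl; exact hw0 (by rw [← h4, zero_smul])
  refine ⟨w, hw0, ?_⟩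
  rintro a (rfl | rfl | rfl)
  · exact ⟨0, by rw [hFw, zero_smul]⟩
  · exact ⟨μ⁻¹, by nth_rewrite 2 [← h4]; rw [smul_smul, inv_mul_cancel₀ hμ0, one_smul]⟩
  · exact ⟨μ, hμ⟩

theorem isBasicAlgebra_shiftedPart [IsAlgClosed k] (hq : q ≠ 0)
    (hr : ∀ n : ℕ, 0 < n → (q ^ 2) ^ n ≠ 1) {s t : k}
    (hst : s * t = q ^ 2 / ((1 - q ^ 2) * (q - q⁻¹))) : IsBasicAlgebra k (shiftedPart q s t) := by
  have hq2 : q ^ 2 ≠ 1 := by simpa using hr 1 one_pos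
  refine isBasicAlgebra_adjoin fun V _ _ _ _ f => ?_
  have hx : shiftE q s ∈ Algebra.adjoin k {E q * Kinv q + s • Kinv q, F q + t • Kinv q} :=
    Algebra.subset_adjoin (Or.inl rfl)
  have hy : shiftF q t ∈ Algebra.adjoin k {E q * Kinv q + s • Kinv q, F q + t • Kinv q} :=
    Algebra.subset_adjoin (Or.inr rfl)
  have h1 : f ⟨_, hx⟩ * f ⟨_, hy⟩ =
      q ^ 2 • (f ⟨_, hy⟩ * f ⟨_, hx⟩) + (q ^ 2 * (q - q⁻¹)⁻¹) • 1 := by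
    rw [← map_mul, ← map_mul, ← map_one f, ← map_smul, ← map_smul, ← map_add]
    exact congrArg f (Subtype.ext (shiftE_mul_shiftF_of_eq hq hq2 hst))
  obtain ⟨w, hw0, hxw, hyw⟩ := Module.End.exists_common_eigenvector_of_quantumWeyl
    (pow_ne_zero 2 hq) hr (mul_ne_zero (pow_ne_zero 2 hq)
      (inv_ne_zero (sub_inv_ne_zero hq hq2))) h1
  refine ⟨w, hw0, ?_⟩
  rintro a (rfl | rfl)
  · exact hxw
  · exact hyw

end Classification

/-! ### Maximality and the classification. -/

section Borel

variable {k : Type u} [Field k] {q : k}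

theorem rep2_shiftE (hq : q ≠ 0) (hq2 : q ^ 2 ≠ 1) (s : k) :
    rep2 hq hq2 (E q * Kinv q + s • Kinv q) = !![s * q⁻¹, q; 0, s * q] := by
  rw [map_add, map_mul, map_smul, rep2_E, rep2_Kinv]
  simp

theorem rep2_shiftF (hq : q ≠ 0) (hq2 : q ^ 2 ≠ 1) (t : k) :
    rep2 hq hq2 (F q + t • Kinv q) = !![t * q⁻¹, 0; 1, t * q] := by
  rw [map_add, map_smul, rep2_F, rep2_Kinv]
  simp

theorem Stabilizes.exists_eq {hq : q ≠ 0} {hq2 : q ^ 2 ≠ 1} {C : Subalgebra k (Uqsl2 q)}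
    {a b : k} (h : Stabilizes hq hq2 C ![a, b]) {c : Uqsl2 q} (hc : c ∈ C) :
    ∃ μ : k, rep2 hq hq2 c 0 0 * a + rep2 hq hq2 c 0 1 * b = μ * a ∧
      rep2 hq hq2 c 1 0 * a + rep2 hq hq2 c 1 1 * b = μ * b := by
  obtain ⟨μ, hμ⟩ := h c hc
  refine ⟨μ, ?_, ?_⟩
  · simpa [Matrix.mulVec, dotProduct, Fin.sum_univ_two] using congrFun hμ 0
  · simpa [Matrix.mulVec, dotProduct, Fin.sum_univ_two] using congrFun hμ 1

/-- Every basic right coideal subalgebra stabilizes a line in the two-dimensional representation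
and is contained in the corresponding Borel subalgebra. -/
theorem stabilizes_and_le_of_isBasicAlgebra (hq : q ≠ 0) (hr : ∀ n : ℕ, 0 < n → q ^ n ≠ 1)
    (hq2 : q ^ 2 ≠ 1) {C : Subalgebra k (Uqsl2 q)} (hC : IsRightCoidealSubalgebra C)
    (hb : IsBasicAlgebra k C) :
    (Stabilizes hq hq2 C ![1, 0] ∧ C ≤ nonnegPart q) ∨
    (Stabilizes hq hq2 C ![0, 1] ∧ C ≤ nonposPart q) ∨
    ∃ s t : k, s * t = q ^ 2 / ((1 - q ^ 2) * (q - q⁻¹)) ∧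
      Stabilizes hq hq2 C ![1, s * (1 - (q ^ 2)⁻¹)] ∧ C ≤ shiftedPart q s t := by
  have hr2 : ∀ n : ℕ, 0 < n → (q ^ 2) ^ n ≠ 1 := fun n hn => by
    rw [← pow_mul]; exact hr _ (by omega)
  have hq20 : q ^ 2 ≠ 0 := pow_ne_zero 2 hq
  rcases exists_stabilizes_normalized hq hq2 hb with h | h | ⟨b, hb0, h⟩
  · refine Or.inl ⟨h, h.le_nonnegPart hq hq2 (fun n hn => ?_) hC⟩
    rw [inv_pow, ne_eq, inv_eq_one]
    exact hr2 n hn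
  · exact Or.inr (Or.inl ⟨h, h.le_nonposPart hq hq2 hr2 hC⟩)
  · have h1 : 1 - (q ^ 2)⁻¹ ≠ 0 := by
      rw [sub_ne_zero, ne_comm, ne_eq, inv_eq_one]; exact hq2
    have h2 : q⁻¹ - q ≠ 0 := by
      rw [← neg_sub, neg_ne_zero]; exact sub_inv_ne_zero hq hq2
    have h3 : 1 - q ^ 2 ≠ 0 := sub_ne_zero.2 hq2.symm
    have h4 : q ^ 2 - 1 ≠ 0 := sub_ne_zero.2 hq2
    have hbs : b = b / (1 - (q ^ 2)⁻¹) * (1 - (q ^ 2)⁻¹) := by rw [div_mul_cancel₀ _ h1]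
    have hrz : ∀ n : ℤ, n ≠ 0 → q ^ n ≠ q ^ (-n) := by
      intro n hn h5
      have h6 : q ^ (2 * n) = 1 := by
        rw [two_mul, zpow_add₀ hq]
        nth_rewrite 2 [h5]
        rw [← zpow_add₀ hq, add_neg_cancel, zpow_zero]
      rcases Int.natAbs_eq (2 * n) with h7 | h7
      · rw [h7, zpow_natCast] at h6; exact hr _ (by omega) h6
      · rw [h7, zpow_neg, zpow_natCast, inv_eq_one] at h6; exact hr _ (by omega) h6
    -- These values of `s` and `t` solve the two eigencolumn conditions `b = s (1 - q⁻²)` and `1 + b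
    -- t q = b t q⁻¹`.
    refine Or.inr (Or.inr ⟨b / (1 - (q ^ 2)⁻¹), (b * (q⁻¹ - q))⁻¹, ?_, hbs ▸ h,
      h.le_shiftedPart hq hq2 hrz hbs ?_ hC⟩)
    · have e1 : 1 - (q ^ 2)⁻¹ = (q ^ 2 - 1) / q ^ 2 := by field_simp
      have e2 : q⁻¹ - q = (1 - q ^ 2) / q := by field_simp
      have e3 : q - q⁻¹ = (q ^ 2 - 1) / q := by field_simp
      rw [e1, e2, e3]
      field_simp
    · have e : b * (b * (q⁻¹ - q))⁻¹ * (q⁻¹ - q) = 1 := by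
        rw [mul_right_comm, mul_inv_cancel₀ (mul_ne_zero hb0 h2)]
      linear_combination -e

/-- A Borel subalgebra equals the listed algebra that contains it. Conversely, if a basic coideal
subalgebra `C` contains a listed one, the generators of the latter leave only one possible line for
`C`, and this bounds `C` from above. -/
theorem isBorelSubalgebra_iff [IsAlgClosed k] (hq : q ≠ 0)
    (hr : ∀ n : ℕ, 0 < n → q ^ n ≠ 1) (B : Subalgebra k (Uqsl2 q)) :
    IsBorelSubalgebra B ↔
      B = nonnegPart q ∨ B = nonposPart q ∨
        ∃ s t : k, s * t = q ^ 2 / ((1 - q ^ 2) * (q - q⁻¹)) ∧ B = shiftedPart q s t := by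
  have hq2 : q ^ 2 ≠ 1 := hr 2 two_pos
  have hr2 : ∀ n : ℕ, 0 < n → (q ^ 2) ^ n ≠ 1 := fun n hn => by
    rw [← pow_mul]; exact hr _ (by omega)
  constructor
  · intro hB
    rcases stabilizes_and_le_of_isBasicAlgebra hq hr hq2 hB.prop.1 hB.prop.2 with
      ⟨-, h⟩ | ⟨-, h⟩ | ⟨s, t, hst, -, h⟩
    · exact Or.inl (hB.eq_of_le
        ⟨isRightCoidealSubalgebra_nonnegPart, isBasicAlgebra_nonnegPart hq hr2⟩ h)
    · exact Or.inr (Or.inl (hB.eq_of_le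
        ⟨isRightCoidealSubalgebra_nonposPart, isBasicAlgebra_nonposPart hq hr2⟩ h))
    · exact Or.inr (Or.inr ⟨s, t, hst, hB.eq_of_le
        ⟨isRightCoidealSubalgebra_shiftedPart s t, isBasicAlgebra_shiftedPart hq hr2 hst⟩ h⟩)
  · have h1 : 1 - (q ^ 2)⁻¹ ≠ 0 := by
      rw [sub_ne_zero, ne_comm, ne_eq, inv_eq_one]; exact hq2
    have hne : ∀ {s t : k}, s * t = q ^ 2 / ((1 - q ^ 2) * (q - q⁻¹)) → s ≠ 0 := by
      rintro s t hst rfl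
      rw [zero_mul] at hst
      exact div_ne_zero (pow_ne_zero 2 hq)
        (mul_ne_zero (sub_ne_zero.2 hq2.symm) (sub_inv_ne_zero hq hq2)) hst.symm
    rintro (rfl | rfl | ⟨s, t, hst, rfl⟩)
    · refine ⟨⟨isRightCoidealSubalgebra_nonnegPart, isBasicAlgebra_nonnegPart hq hr2⟩, ?_⟩
      rintro C ⟨hC, hCb⟩ hle
      have hE : E q ∈ nonnegPart q := Algebra.subset_adjoin (by simp)
      -- `E` preserves the line of `(1, 0)` but neither that of `(0, 1)` nor that of `(1, b)` with
      -- `b ≠ 0`.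
      rcases stabilizes_and_le_of_isBasicAlgebra hq hr hq2 hC hCb with
        ⟨-, h⟩ | ⟨hs, -⟩ | ⟨s, t, hst, hs, -⟩
      · exact h
      · obtain ⟨μ, h2, h3⟩ := hs.exists_eq (hle hE)
        simp [rep2_E] at h2
      · obtain ⟨μ, h2, h3⟩ := hs.exists_eq (hle hE)
        have h4 := mul_ne_zero (hne hst) h1
        simp only [rep2_E, Matrix.of_apply, Matrix.cons_val, zero_mul, zero_add, one_mul,
          mul_one] at h2 h3
        exact absurd h3.symm (mul_ne_zero (h2 ▸ h4) h4)
    · refine ⟨⟨isRightCoidealSubalgebra_nonposPart, isBasicAlgebra_nonposPart hq hr2⟩, ?_⟩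
      rintro C ⟨hC, hCb⟩ hle
      have hF : F q ∈ nonposPart q := Algebra.subset_adjoin (by simp)
      rcases stabilizes_and_le_of_isBasicAlgebra hq hr hq2 hC hCb with
        ⟨hs, -⟩ | ⟨-, h⟩ | ⟨s, t, hst, hs, -⟩
      · obtain ⟨μ, h2, h3⟩ := hs.exists_eq (hle hF)
        simp [rep2_F] at h3
      · exact h
      · obtain ⟨μ, h2, h3⟩ := hs.exists_eq (hle hF)
        simp only [rep2_F, Matrix.of_apply, Matrix.cons_val, zero_mul, add_zero,
          mul_one] at h2 h3
        rw [← h2, zero_mul] at h3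
        exact absurd h3 one_ne_zero
    · refine ⟨⟨isRightCoidealSubalgebra_shiftedPart s t,
        isBasicAlgebra_shiftedPart hq hr2 hst⟩, ?_⟩
      rintro C ⟨hC, hCb⟩ hle
      have hx : E q * Kinv q + s • Kinv q ∈ shiftedPart q s t :=
        Algebra.subset_adjoin (Or.inl rfl)
      have hy : F q + t • Kinv q ∈ shiftedPart q s t := Algebra.subset_adjoin (Or.inr rfl)
      -- `F + t K⁻¹` moves the line of `(1, 0)` and `E K⁻¹ + s K⁻¹` moves that of `(0, 1)`, so only
      -- a line with both coordinates nonzero remains.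
      rcases stabilizes_and_le_of_isBasicAlgebra hq hr hq2 hC hCb with
        ⟨hs, -⟩ | ⟨hs, -⟩ | ⟨s', t', hst', hs, h⟩
      · obtain ⟨μ, h2, h3⟩ := hs.exists_eq (hle hy)
        simp [rep2_shiftF] at h3
      · obtain ⟨μ, h2, h3⟩ := hs.exists_eq (hle hx)
        simp [rep2_shiftE, hq] at h2
      · obtain ⟨μ, h2, h3⟩ := hs.exists_eq (hle hx)
        simp only [rep2_shiftE, Matrix.of_apply, Matrix.cons_val, zero_add,
          mul_one] at h2 h3
        -- On such a line the eigenvalue of `E K⁻¹ + s K⁻¹` must be `s q`. The other coordinate then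
        -- determines the slope, hence `s'`, and the fixed product determines `t'`.
        have h4 : s * q = μ := mul_right_cancel₀ (mul_ne_zero (hne hst') h1) h3
        have hss : s' = s := by
          have h5 : q * (1 - (q ^ 2)⁻¹) ≠ 0 := mul_ne_zero hq h1
          apply mul_right_cancel₀ h5
          have h6 : q * (q ^ 2)⁻¹ = q⁻¹ := by field_simp
          linear_combination h2 - h4 + s * h6
        subst hss
        have htt : t' = t := mul_left_cancel₀ (hne hst) (hst'.trans hst.symm)
        rw [htt] at h
        exact h

end Borel

end Uqsl2

/-- The Borel subalgebras of `U_q(sl_2)`, for `q` not a root of unity over an algebraically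
closed field of characteristic zero, are exactly `U^{≥0}`, `U^{≤0}` and the algebras
`B_{s,t}` with `s t = q² / ((1 - q²) (q - q⁻¹))`. -/
theorem mainTheorem1 {k : Type u} [Field k] [IsAlgClosed k] [CharZero k] (q : k) (hq0 : q ≠ 0)
    (hq : ∀ n : ℕ, 0 < n → q ^ n ≠ 1) (B : Subalgebra k (Uqsl2 q)) :
    IsBorelSubalgebra B ↔
      B = Uqsl2.nonnegPart q ∨ B = Uqsl2.nonposPart q ∨
        ∃ s t : k, s * t = q ^ 2 / ((1 - q ^ 2) * (q - q⁻¹)) ∧ B = Uqsl2.shiftedPart q s t :=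
  Uqsl2.isBorelSubalgebra_iff hq0 hq B
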